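/- Let $f=P/Q:\widehat{\mathbb C}\to\widehat{\mathbb C}$ be a rational map of the Riemann sphere $\widehat{\mathbb C}=\mathbb C\cup\{\infty\}$ ($P,Q$ coprime complex polynomials) of degree $\max(\deg P,\deg Q)\ge 2$. The Fatou set $\mathcal F_f$ is the largest open subset of $\widehat{\mathbb C}$ on which the iterates $(f^{\circ n})_{n\in\mathbb N}$ form a normal family, i.e. on which every sequence of iterates has a subsequence converging uniformly on compact subsets for the spherical metric in the range; the Julia set is $\mathcal J_f=\widehat{\mathbb C}\setminus\mathcal F_f$. A set $E\subseteq\widehat{\mathbb C}$ is completely invariant if $f(E)=E$ and $f^{-1}(E)=E$. Then $\mathcal J_f$ is the smallest completely invariant closed subset of $\widehat{\mathbb C}$ containing at least three points: $\mathcal J_f$ is closed, completely invariant and has at least three points, and $\mathcal J_f\subseteq E$ for every closed completely invariant set $E\subseteq\widehat{\mathbb C}$ with at least three points. -/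

import Mathlib

open Polynomial OnePoint

noncomputable section

/-- The degree of a rational function `P / Q` in lowest terms: `max (deg P) (deg Q)`. -/
def ratDegree (R : RatFunc ℂ) : ℕ :=
  max R.num.natDegree R.denom.natDegree

/-- The self-map of the Riemann sphere `ℂ ∪ {∞}` given by a rational function `P / Q` in lowest
terms: poles go to `∞`, and the value at `∞` is the limit of `P z / Q z` as `z → ∞`. (If
`deg P < deg Q`, the coefficient of `P` in degree `deg Q` is `0`.) -/
def ratMap (R : RatFunc ℂ) : OnePoint ℂ → OnePoint ℂ
  | ∞ => if R.denom.natDegree < R.num.natDegree then ∞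
      else ((R.num.coeff R.denom.natDegree / R.denom.leadingCoeff : ℂ) : OnePoint ℂ)
  | OnePoint.some z => if R.denom.eval z = 0 then ∞
      else ((R.num.eval z / R.denom.eval z : ℂ) : OnePoint ℂ)

/-- The (chordal) spherical metric on the Riemann sphere: the Euclidean distance in `ℝ³` between
the points of the unit sphere that correspond to the arguments under stereographic projection. -/
def sphericalDist : OnePoint ℂ → OnePoint ℂ → ℝ
  | ∞, ∞ => 0
  | ∞, OnePoint.some w => 2 / √(1 + ‖w‖ ^ 2)
  | OnePoint.some z, ∞ => 2 / √(1 + ‖z‖ ^ 2)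
  | OnePoint.some z, OnePoint.some w => 2 * ‖z - w‖ / (√(1 + ‖z‖ ^ 2) * √(1 + ‖w‖ ^ 2))

/-- The maps `F n` converge to `g` uniformly, for the spherical metric in the range, on every
compact subset of `U`. -/
def ConvergesOnCompacts (F : ℕ → OnePoint ℂ → OnePoint ℂ) (g : OnePoint ℂ → OnePoint ℂ)
    (U : Set (OnePoint ℂ)) : Prop :=
  ∀ K : Set (OnePoint ℂ), K ⊆ U → IsCompact K →
    ∀ ε : ℝ, 0 < ε → ∃ N : ℕ, ∀ n : ℕ, N ≤ n → ∀ z ∈ K, sphericalDist (F n z) (g z) < ε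

/-- The family of maps `F a`, restricted to `U`, is normal: every sequence of members has a
subsequence that converges uniformly on compact subsets of `U`. Only the values of the limit `g`
on `U` matter. -/
def IsNormalFamilyOn {ι : Type*} (F : ι → OnePoint ℂ → OnePoint ℂ) (U : Set (OnePoint ℂ)) :
    Prop :=
  ∀ a : ℕ → ι, ∃ k : ℕ → ℕ, StrictMono k ∧
    ∃ g : OnePoint ℂ → OnePoint ℂ, ConvergesOnCompacts (fun n => F (a (k n))) g U

/-- The Fatou set: the largest open set on which the iterates of `f` form a normal family, that
is, the union of all such open sets (normality on an open set is a local property). -/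
def fatouSet (f : OnePoint ℂ → OnePoint ℂ) : Set (OnePoint ℂ) :=
  ⋃₀ {U | IsOpen U ∧ IsNormalFamilyOn (fun n : ℕ => f^[n]) U}

/-- The Julia set: the complement of the Fatou set. -/
def juliaSet (f : OnePoint ℂ → OnePoint ℂ) : Set (OnePoint ℂ) :=
  (fatouSet f)ᶜ

/-- `E` is completely invariant under `f`. -/
def IsCompletelyInvariant (f : OnePoint ℂ → OnePoint ℂ) (E : Set (OnePoint ℂ)) : Prop :=
  f '' E = E ∧ f ⁻¹' E = E

end

/-! Points of the sphere are lines in `ℂ × ℂ`. The chordal distance becomes `2|u ∧ v| / (|u||v|)`,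
and a rational map of degree `d` lifts to a homogeneous polynomial map `F` of degree `d` vanishing
only at the origin (`IsHomogeneousLift`). In both directions of Arzelà–Ascoli, normality of the
iterates near `x` means equicontinuity at every point near `x` (`mem_fatouSet_iff`). Since `f` is
continuous, open and surjective, equicontinuity passes between `x` and `f x`, so the Julia set is
completely invariant.

Minimality is Montel's theorem: on the complement of `E` all iterates omit three points of `E`, and
a cross ratio turns these into `0`, `∞`, `1`. The estimate needed is uniform in the iterate
(`exists_sphericalDist_le_of_omits_zero_one`). It comes from Schottky's theorem: a function omitting
`0` and `1` is `(1 + cosh (πi cosh k)) / 2`, where `k` omits a set meeting every disc of radius 7,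
so a Bloch–Landau argument bounds `k'`.

The Julia set is nonempty: otherwise two iterates of different degrees would be uniformly close on
the whole sphere, hence never antipodal, and a winding number count forces equal degrees
(`degree_eq_of_herm_ne_zero`). It is infinite: if finite, `f` would permute it, each of its points
would be totally ramified, and `dist (f y) (f x) ≤ C * dist y x ^ d` with `d ≥ 2` would make orbits
contract to that of `x`, putting `x` in the Fatou set. -/

/-! ### Homogeneous coordinates and the chordal metric -/

section Chordal

open Filter Topology

/-- The point of the Riemann sphere with homogeneous coordinates `v`. -/
noncomputable def toSphere (v : ℂ × ℂ) : OnePoint ℂ :=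
  if v.2 = 0 then ∞ else ((v.1 / v.2 : ℂ) : OnePoint ℂ)

/-- The determinant of two vectors of `ℂ²`. -/
def wedge (u v : ℂ × ℂ) : ℂ := u.1 * v.2 - u.2 * v.1

/-- The Hermitian inner product of two vectors of `ℂ²`. -/
def herm (u v : ℂ × ℂ) : ℂ := u.1 * star v.1 + u.2 * star v.2

/-- The Euclidean norm on `ℂ²`. -/
noncomputable def euclNorm (v : ℂ × ℂ) : ℝ := √(‖v.1‖ ^ 2 + ‖v.2‖ ^ 2)

theorem euclNorm_sq (v : ℂ × ℂ) : euclNorm v ^ 2 = ‖v.1‖ ^ 2 + ‖v.2‖ ^ 2 :=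
  Real.sq_sqrt (by positivity)

theorem euclNorm_nonneg (v : ℂ × ℂ) : 0 ≤ euclNorm v := Real.sqrt_nonneg _

theorem euclNorm_pos {v : ℂ × ℂ} (hv : v ≠ 0) : 0 < euclNorm v := by
  apply Real.sqrt_pos.2
  by_contra h
  have h1 : ‖v.1‖ ^ 2 + ‖v.2‖ ^ 2 = 0 := le_antisymm (not_lt.1 h) (by positivity)
  have h2 : v.1 = 0 := by
    have : ‖v.1‖ ^ 2 = 0 := by nlinarith [sq_nonneg ‖v.1‖, sq_nonneg ‖v.2‖]
    simpa using this
  have h3 : v.2 = 0 := by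
    have : ‖v.2‖ ^ 2 = 0 := by nlinarith [sq_nonneg ‖v.1‖, sq_nonneg ‖v.2‖]
    simpa using this
  exact hv (Prod.ext h2 h3)

@[fun_prop]
theorem continuous_euclNorm : Continuous euclNorm := by
  unfold euclNorm; fun_prop

theorem euclNorm_smul (t : ℂ) (v : ℂ × ℂ) : euclNorm (t • v) = ‖t‖ * euclNorm v := by
  unfold euclNorm
  simp only [Prod.smul_fst, Prod.smul_snd, smul_eq_mul, norm_mul, mul_pow]
  rw [← mul_add, Real.sqrt_mul (by positivity), Real.sqrt_sq (norm_nonneg _)]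

/-- Lagrange's identity, the `sin² + cos² = 1` of the chordal metric. -/
theorem norm_wedge_sq_add_norm_herm_sq (u v : ℂ × ℂ) :
    ‖wedge u v‖ ^ 2 + ‖herm u v‖ ^ 2 = euclNorm u ^ 2 * euclNorm v ^ 2 := by
  rw [euclNorm_sq, euclNorm_sq]
  simp only [wedge, herm, Complex.sq_norm, Complex.normSq_apply, Complex.star_def, Complex.add_re,
    Complex.sub_re, Complex.mul_re, Complex.conj_re, Complex.conj_im, Complex.add_im,
    Complex.sub_im, Complex.mul_im]
  ring

theorem norm_herm_le (u v : ℂ × ℂ) : ‖herm u v‖ ≤ euclNorm u * euclNorm v := by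
  apply le_of_sq_le_sq _ (mul_nonneg (euclNorm_nonneg u) (euclNorm_nonneg v))
  rw [mul_pow, ← norm_wedge_sq_add_norm_herm_sq]
  nlinarith [sq_nonneg ‖wedge u v‖]

/-- Comes from expanding `u` and `w` in the orthogonal basis given by `v` and its perpendicular.
With Cauchy–Schwarz it yields the triangle inequality for the chordal distance. -/
theorem euclNorm_sq_mul_wedge (u v w : ℂ × ℂ) :
    ((euclNorm v ^ 2 : ℝ) : ℂ) * wedge u w = herm u v * wedge v w + wedge u v * herm w v := by
  rw [euclNorm_sq]
  have h (z : ℂ) : ((‖z‖ ^ 2 : ℝ) : ℂ) = z * star z := by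
    rw [Complex.star_def, Complex.mul_conj, Complex.normSq_eq_norm_sq]
  rw [Complex.ofReal_add, h, h]
  simp only [wedge, herm]
  ring

theorem wedge_self (u : ℂ × ℂ) : wedge u u = 0 := by simp [wedge, mul_comm]

theorem wedge_smul_right (t : ℂ) (u v : ℂ × ℂ) : wedge u (t • v) = t * wedge u v := by
  simp [wedge]; ring

theorem norm_wedge_comm (u v : ℂ × ℂ) : ‖wedge u v‖ = ‖wedge v u‖ := by
  rw [← norm_neg]; congr 1; simp [wedge]; ring

theorem toSphere_coe (z : ℂ) : toSphere (z, 1) = z := by simp [toSphere]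

theorem toSphere_infty : toSphere (1, 0) = ∞ := by simp [toSphere]

theorem toSphere_smul {t : ℂ} (ht : t ≠ 0) (v : ℂ × ℂ) : toSphere (t • v) = toSphere v := by
  simp only [toSphere, Prod.smul_fst, Prod.smul_snd, smul_eq_mul, mul_eq_zero, ht, false_or]
  rw [mul_div_mul_left _ _ ht]

theorem exists_toSphere_eq (x : OnePoint ℂ) : ∃ v : ℂ × ℂ, v ≠ 0 ∧ toSphere v = x := by
  induction x using OnePoint.rec with
  | infty => exact ⟨(1, 0), by simp, toSphere_infty⟩
  | coe z => exact ⟨(z, 1), by simp, toSphere_coe z⟩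

theorem sphericalDist_toSphere {u v : ℂ × ℂ} (hu : u ≠ 0) (hv : v ≠ 0) :
    sphericalDist (toSphere u) (toSphere v) = 2 * ‖wedge u v‖ / (euclNorm u * euclNorm v) := by
  have hN (w : ℂ × ℂ) (hw : w.2 ≠ 0) : euclNorm w = ‖w.2‖ * √(1 + ‖w.1 / w.2‖ ^ 2) := by
    have h0 : 0 < ‖w.2‖ := norm_pos_iff.2 hw
    rw [euclNorm, ← Real.sqrt_sq h0.le, ← Real.sqrt_mul (by positivity), Real.sqrt_sq h0.le,
      norm_div]
    congr 1; field_simp; ring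
  have hN0 (w : ℂ × ℂ) (hw : w.2 = 0) : euclNorm w = ‖w.1‖ := by simp [euclNorm, hw]
  have hne (w : ℂ × ℂ) (hw0 : w ≠ 0) (hw : w.2 = 0) : ‖w.1‖ ≠ 0 := by
    rw [norm_ne_zero_iff]; exact fun h => hw0 (Prod.ext h hw)
  have hs (z : ℂ) : √(1 + ‖z‖ ^ 2) ≠ 0 := by positivity
  unfold toSphere
  by_cases h1 : u.2 = 0 <;> by_cases h2 : v.2 = 0
  · simp [h1, h2, wedge, sphericalDist]
  · rw [if_pos h1, if_neg h2, hN0 u h1, hN v h2]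
    have := hne u hu h1
    have := hs (v.1 / v.2)
    have : ‖v.2‖ ≠ 0 := norm_ne_zero_iff.2 h2
    simp only [sphericalDist, wedge, h1, zero_mul, sub_zero, norm_mul]
    field_simp
  · rw [if_neg h1, if_pos h2, hN0 v h2, hN u h1]
    have := hne v hv h2
    have := hs (u.1 / u.2)
    have : ‖u.2‖ ≠ 0 := norm_ne_zero_iff.2 h1
    simp only [sphericalDist, wedge, h2, mul_zero, zero_sub, norm_mul, norm_neg]
    field_simp
  · rw [if_neg h1, if_neg h2, hN v h2, hN u h1]
    have e : u.1 / u.2 - v.1 / v.2 = wedge u v / (u.2 * v.2) := by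
      unfold wedge; field_simp
    have := hs (u.1 / u.2)
    have := hs (v.1 / v.2)
    have : ‖u.2‖ ≠ 0 := norm_ne_zero_iff.2 h1
    have : ‖v.2‖ ≠ 0 := norm_ne_zero_iff.2 h2
    simp only [sphericalDist]
    rw [e, norm_div, norm_mul]
    field_simp

theorem wedge_eq_zero_iff {u v : ℂ × ℂ} (hu : u ≠ 0) (hv : v ≠ 0) :
    wedge u v = 0 ↔ toSphere u = toSphere v := by
  unfold wedge toSphere
  by_cases h1 : u.2 = 0 <;> by_cases h2 : v.2 = 0
  · simp [h1, h2]
  · have : u.1 ≠ 0 := fun h => hu (Prod.ext h h1)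
    simp [h1, h2, this]
  · have : v.1 ≠ 0 := fun h => hv (Prod.ext h h2)
    simp [h1, h2, this]
  · simp only [h1, h2, if_false, OnePoint.coe_eq_coe]
    rw [div_eq_div_iff h1 h2, sub_eq_zero, mul_comm u.2]

theorem sphericalDist_self (x : OnePoint ℂ) : sphericalDist x x = 0 := by
  obtain ⟨u, hu, rfl⟩ := exists_toSphere_eq x
  simp [sphericalDist_toSphere hu hu, wedge_self]

theorem sphericalDist_comm (x y : OnePoint ℂ) : sphericalDist x y = sphericalDist y x := by
  obtain ⟨u, hu, rfl⟩ := exists_toSphere_eq x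
  obtain ⟨v, hv, rfl⟩ := exists_toSphere_eq y
  rw [sphericalDist_toSphere hu hv, sphericalDist_toSphere hv hu, norm_wedge_comm,
    mul_comm (euclNorm u)]

theorem sphericalDist_nonneg (x y : OnePoint ℂ) : 0 ≤ sphericalDist x y := by
  obtain ⟨u, hu, rfl⟩ := exists_toSphere_eq x
  obtain ⟨v, hv, rfl⟩ := exists_toSphere_eq y
  rw [sphericalDist_toSphere hu hv]
  have := euclNorm_nonneg u
  have := euclNorm_nonneg v
  positivity

theorem eq_of_sphericalDist_eq_zero {x y : OnePoint ℂ} (h : sphericalDist x y = 0) : x = y := by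
  obtain ⟨u, hu, rfl⟩ := exists_toSphere_eq x
  obtain ⟨v, hv, rfl⟩ := exists_toSphere_eq y
  rw [sphericalDist_toSphere hu hv] at h
  have := (euclNorm_pos hu).ne'
  have := (euclNorm_pos hv).ne'
  rw [← wedge_eq_zero_iff hu hv]
  simp_all

theorem sphericalDist_triangle (x y z : OnePoint ℂ) :
    sphericalDist x z ≤ sphericalDist x y + sphericalDist y z := by
  obtain ⟨u, hu, rfl⟩ := exists_toSphere_eq x
  obtain ⟨v, hv, rfl⟩ := exists_toSphere_eq y
  obtain ⟨w, hw, rfl⟩ := exists_toSphere_eq z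
  rw [sphericalDist_toSphere hu hv, sphericalDist_toSphere hu hw, sphericalDist_toSphere hv hw]
  have hu' := euclNorm_pos hu
  have hv' := euclNorm_pos hv
  have hw' := euclNorm_pos hw
  have key : euclNorm v ^ 2 * ‖wedge u w‖ ≤
      euclNorm u * euclNorm v * ‖wedge v w‖ + ‖wedge u v‖ * (euclNorm w * euclNorm v) := by
    calc euclNorm v ^ 2 * ‖wedge u w‖ = ‖((euclNorm v ^ 2 : ℝ) : ℂ) * wedge u w‖ := by
          rw [norm_mul, Complex.norm_real, Real.norm_of_nonneg (by positivity)]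
      _ ≤ ‖herm u v‖ * ‖wedge v w‖ + ‖wedge u v‖ * ‖herm w v‖ := by
          rw [euclNorm_sq_mul_wedge, ← norm_mul, ← norm_mul]; exact norm_add_le _ _
      _ ≤ _ := by gcongr <;> apply norm_herm_le
  rw [div_add_div _ _ (by positivity) (by positivity), div_le_div_iff₀ (by positivity)
    (by positivity)]
  have : 0 < 2 * (euclNorm u * euclNorm w) := by positivity
  nlinarith [mul_le_mul_of_nonneg_left key (by positivity :
    0 ≤ 2 * (euclNorm u * euclNorm w))]

theorem sphericalDist_coe_le (z w : ℂ) : sphericalDist z w ≤ 2 * ‖z - w‖ := by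
  simp only [sphericalDist]
  apply div_le_self (by positivity)
  have h (z : ℂ) : 1 ≤ √(1 + ‖z‖ ^ 2) := by
    rw [Real.one_le_sqrt]; nlinarith [sq_nonneg ‖z‖]
  nlinarith [h z, h w]

/-- Inversion swaps the two homogeneous coordinates, which preserves norms and `|u ∧ v|`. -/
theorem sphericalDist_inv {z w : ℂ} (hz : z ≠ 0) (hw : w ≠ 0) :
    sphericalDist ((z⁻¹ : ℂ) : OnePoint ℂ) ((w⁻¹ : ℂ) : OnePoint ℂ) = sphericalDist z w := by
  have h (z : ℂ) (hz : z ≠ 0) : ((z⁻¹ : ℂ) : OnePoint ℂ) = toSphere (1, z) := by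
    simp [toSphere, hz]
  rw [h z hz, h w hw, ← toSphere_coe z, ← toSphere_coe w, sphericalDist_toSphere (by simp)
    (by simp), sphericalDist_toSphere (by simp) (by simp), norm_wedge_comm]
  simp [euclNorm, wedge, add_comm]

theorem eventually_sphericalDist_lt (x : OnePoint ℂ) {ε : ℝ} (hε : 0 < ε) :
    ∀ᶠ y in 𝓝 x, sphericalDist x y < ε := by
  induction x using OnePoint.rec with
  | infty =>
    rw [OnePoint.nhds_infty_eq, eventually_sup]
    refine ⟨?_, by simpa [sphericalDist] using hε⟩
    rw [eventually_map]
    have h : Tendsto (fun z : ℂ => 2 / √(1 + ‖z‖ ^ 2)) (coclosedCompact ℂ) (𝓝 0) := by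
      rw [coclosedCompact_eq_cocompact]
      apply Tendsto.const_div_atTop
      apply Real.tendsto_sqrt_atTop.comp
      apply tendsto_atTop_add_const_left
      exact (tendsto_pow_atTop two_ne_zero).comp (tendsto_norm_cocompact_atTop (E := ℂ))
    exact h.eventually (gt_mem_nhds hε)
  | coe z =>
    rw [OnePoint.nhds_coe_eq, eventually_map]
    filter_upwards [Metric.ball_mem_nhds z (half_pos hε)] with w hw
    refine (sphericalDist_coe_le z w).trans_lt ?_
    rw [Metric.mem_ball, dist_comm, dist_eq_norm] at hw
    linarith

theorem continuous_sphericalDist_right (x : OnePoint ℂ) : Continuous (sphericalDist x) := by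
  rw [continuous_iff_continuousAt]
  intro y
  rw [Metric.continuousAt_iff']
  intro ε hε
  filter_upwards [eventually_sphericalDist_lt y hε] with z hz
  rw [Real.dist_eq, abs_lt]
  constructor <;> linarith [sphericalDist_triangle x y z, sphericalDist_triangle x z y,
    sphericalDist_comm y z]

/-- Lets the chordal metric be installed without changing the topology of the one-point
compactification. The forward direction minimises the distance to `x` over the compact complement.
-/
theorem isOpen_iff_sphericalDist (s : Set (OnePoint ℂ)) :
    IsOpen s ↔ ∀ x ∈ s, ∃ ε > 0, ∀ y, sphericalDist x y < ε → y ∈ s := by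
  constructor
  · intro hs x hx
    rcases sᶜ.eq_empty_or_nonempty with h | h
    · exact ⟨1, one_pos, fun y _ => by rw [Set.compl_empty_iff.1 h]; trivial⟩
    obtain ⟨y, hy, hmin⟩ := (hs.isClosed_compl.isCompact).exists_isMinOn h
      (continuous_sphericalDist_right x).continuousOn
    refine ⟨sphericalDist x y, (sphericalDist_nonneg x y).lt_of_ne fun h0 => hy ?_, ?_⟩
    · rwa [← eq_of_sphericalDist_eq_zero h0.symm]
    · intro z hz
      by_contra hzs
      exact absurd (hmin hzs) (not_le.2 hz)
  · intro h
    rw [isOpen_iff_eventually]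
    intro x hx
    obtain ⟨ε, hε, H⟩ := h x hx
    filter_upwards [eventually_sphericalDist_lt x hε] with y hy using H y hy

/-- The Riemann sphere as a metric space, with the chordal metric. -/
noncomputable abbrev sphereMetricSpace : MetricSpace (OnePoint ℂ) :=
  { PseudoMetricSpace.ofDistTopology sphericalDist sphericalDist_self sphericalDist_comm
      sphericalDist_triangle isOpen_iff_sphericalDist with
    eq_of_dist_eq_zero := eq_of_sphericalDist_eq_zero }

attribute [local instance] sphereMetricSpace

theorem sphere_dist_eq (x y : OnePoint ℂ) : dist x y = sphericalDist x y := rfl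

theorem dist_toSphere {u v : ℂ × ℂ} (hu : u ≠ 0) (hv : v ≠ 0) :
    dist (toSphere u) (toSphere v) = 2 * ‖wedge u v‖ / (euclNorm u * euclNorm v) :=
  sphericalDist_toSphere hu hv

theorem continuousAt_toSphere {u : ℂ × ℂ} (hu : u ≠ 0) : ContinuousAt toSphere u := by
  rw [ContinuousAt, tendsto_iff_dist_tendsto_zero]
  have h : Tendsto (fun v => 2 * ‖wedge v u‖ / (euclNorm v * euclNorm u)) (𝓝 u) (𝓝 0) := by
    have h0 : 2 * ‖wedge u u‖ / (euclNorm u * euclNorm u) = 0 := by simp [wedge_self]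
    rw [← h0]
    have := (euclNorm_pos hu).ne'
    apply ContinuousAt.tendsto
    apply ContinuousAt.div
    · unfold wedge; fun_prop
    · fun_prop
    · positivity
  refine h.congr' ?_
  filter_upwards [isOpen_ne.mem_nhds hu] with v hv
  rw [dist_toSphere hv hu]

theorem nhds_toSphere {u : ℂ × ℂ} (hu : u ≠ 0) : map toSphere (𝓝 u) = 𝓝 (toSphere u) := by
  apply le_antisymm (continuousAt_toSphere hu)
  have hu' := euclNorm_pos hu
  intro s hs
  rw [mem_map, Metric.mem_nhds_iff] at hs
  obtain ⟨ε, hε, hs⟩ := hs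
  rw [Metric.mem_nhds_iff]
  -- The radius 1 excludes `v` orthogonal to `u`, which would be at distance 2. The other bound says
  -- exactly that the distance `|u ∧ v| / |v|` from `u` to the line of `v` is less than `ε`.
  refine ⟨min (2 * ε / euclNorm u) 1, by positivity, fun x hx => ?_⟩
  obtain ⟨v, hv, rfl⟩ := exists_toSphere_eq x
  have hv' := euclNorm_pos hv
  rw [Metric.mem_ball, dist_comm, dist_toSphere hu hv, lt_min_iff] at hx
  obtain ⟨h1, h2⟩ := hx
  have hh := norm_wedge_sq_add_norm_herm_sq u v
  have hherm : herm u v ≠ 0 := by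
    intro h0
    rw [h0, norm_zero, zero_pow two_ne_zero, add_zero, ← mul_pow] at hh
    rw [(pow_left_inj₀ (norm_nonneg _) (by positivity) two_ne_zero).1 hh,
      mul_div_assoc, div_self (by positivity)] at h2
    norm_num at h2
  -- `t • v` is the orthogonal projection of `u` to the line spanned by `v`, the representative of
  -- `toSphere v` nearest to `u`.
  set t : ℂ := herm u v / ((euclNorm v ^ 2 : ℝ) : ℂ) with ht
  have hc : ((euclNorm v ^ 2 : ℝ) : ℂ) ≠ 0 := by
    rw [Complex.ofReal_ne_zero]; positivity
  have ht0 : t ≠ 0 := div_ne_zero hherm hc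
  rw [← toSphere_smul ht0]
  apply hs
  have h (z : ℂ) : ((‖z‖ ^ 2 : ℝ) : ℂ) = z * star z := by
    rw [Complex.star_def, Complex.mul_conj, Complex.normSq_eq_norm_sq]
  have e1 : t * v.1 - u.1 = - wedge u v * star v.2 / ((euclNorm v ^ 2 : ℝ) : ℂ) := by
    rw [ht]; field_simp
    rw [euclNorm_sq, Complex.ofReal_add, h, h]
    simp only [wedge, herm]; ring
  have e2 : t * v.2 - u.2 = wedge u v * star v.1 / ((euclNorm v ^ 2 : ℝ) : ℂ) := by
    rw [ht]; field_simp
    rw [euclNorm_sq, Complex.ofReal_add, h, h]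
    simp only [wedge, herm]; ring
  have hlt : ‖wedge u v‖ / euclNorm v < ε := by
    have : 2 * ‖wedge u v‖ / (euclNorm u * euclNorm v) * euclNorm u / 2 =
      ‖wedge u v‖ / euclNorm v := by field_simp
    rw [← this]
    rw [lt_div_iff₀ hu'] at h1
    linarith
  have hb1 : ‖v.1‖ ≤ euclNorm v := Real.le_sqrt_of_sq_le (by nlinarith [sq_nonneg ‖v.2‖])
  have hb2 : ‖v.2‖ ≤ euclNorm v := Real.le_sqrt_of_sq_le (by nlinarith [sq_nonneg ‖v.1‖])
  have hfin (a : ℝ) (ha : a ≤ euclNorm v) :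
      ‖wedge u v‖ * a / euclNorm v ^ 2 < ε := by
    refine lt_of_le_of_lt ?_ hlt
    rw [div_le_div_iff₀ (by positivity) hv']
    nlinarith [mul_le_mul_of_nonneg_left ha (by positivity : 0 ≤ ‖wedge u v‖ * euclNorm v)]
  rw [Metric.mem_ball, dist_eq_norm, Prod.norm_def, max_lt_iff]
  simp only [Prod.fst_sub, Prod.snd_sub, Prod.smul_fst, Prod.smul_snd, smul_eq_mul]
  rw [e1, e2, norm_div, norm_div, norm_mul, norm_mul, norm_neg, norm_star, norm_star,
    Complex.norm_real, Real.norm_of_nonneg (by positivity)]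
  exact ⟨hfin _ hb2, hfin _ hb1⟩

end Chordal

/-! ### Bloch–Landau, Schottky and Montel estimates -/

section Schottky

open Filter Topology Metric

/-- By the Schwarz lemma `g'` stays within `|g'(a)| / 2` of `g'(a)` on the ball of radius `r / 6`.
Hence `|g - g(a)| ≥ r|g'(a)| / 12` on its boundary circle, and the quantitative open mapping theorem
covers half that radius. -/
theorem exists_ball_subset_image_of_norm_deriv_le {g : ℂ → ℂ} {a : ℂ} {r : ℝ} (hr : 0 < r)
    (hg : DifferentiableOn ℂ g (ball a r)) (h0 : deriv g a ≠ 0)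
    (hd : ∀ z ∈ ball a r, ‖deriv g z‖ ≤ 2 * ‖deriv g a‖) :
    ball (g a) (r * ‖deriv g a‖ / 24) ⊆ g '' ball a r := by
  have hA : 0 < ‖deriv g a‖ := norm_pos_iff.2 h0
  have hmaps : Set.MapsTo (deriv g) (ball a r) (closedBall (deriv g a) (3 * ‖deriv g a‖)) := by
    intro z hz
    rw [mem_closedBall, dist_eq_norm]
    linarith [norm_sub_le (deriv g z) (deriv g a), hd z hz]
  have hsub : closedBall a (r / 6) ⊆ ball a r := closedBall_subset_ball (by linarith)
  have hdiff (z : ℂ) (hz : z ∈ ball a r) : DifferentiableAt ℂ g z :=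
    hg.differentiableAt (isOpen_ball.mem_nhds hz)
  have hder (z : ℂ) (hz : z ∈ closedBall a (r / 6)) :
      ‖deriv (fun z => g z - deriv g a * z) z‖ ≤ ‖deriv g a‖ / 2 := by
    have h1 := Complex.dist_le_div_mul_dist_of_mapsTo_ball (hg.deriv isOpen_ball) hmaps (hsub hz)
    have h2 : deriv (fun z => g z - deriv g a * z) z = deriv g z - deriv g a := by
      have := ((hdiff z (hsub hz)).hasDerivAt.fun_sub
        ((hasDerivAt_id z).const_mul (deriv g a))).deriv
      simpa using this
    rw [h2, ← dist_eq_norm]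
    refine h1.trans ?_
    have h3 : dist z a ≤ r / 6 := hz
    calc 3 * ‖deriv g a‖ / r * dist z a ≤ 3 * ‖deriv g a‖ / r * (r / 6) := by gcongr
      _ = ‖deriv g a‖ / 2 := by field_simp; norm_num
  have hlow (z : ℂ) (hz : z ∈ sphere a (r / 6)) : r * ‖deriv g a‖ / 12 ≤ ‖g z - g a‖ := by
    have h1 := (convex_closedBall a (r / 6)).norm_image_sub_le_of_norm_deriv_le
      (f := fun z => g z - deriv g a * z) (fun z hz => by
        have := hdiff z (hsub hz)
        fun_prop) hder (mem_closedBall_self (by linarith)) (sphere_subset_closedBall hz)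
    have h2 : ‖z - a‖ = r / 6 := by rw [← dist_eq_norm]; exact hz
    have h3 : ‖deriv g a * (z - a)‖ ≤
        ‖g z - g a‖ + ‖g z - deriv g a * z - (g a - deriv g a * a)‖ := by
      refine le_trans (le_of_eq ?_) (norm_sub_le _ _)
      congr 1; ring
    rw [norm_mul, h2] at h3
    rw [h2] at h1
    linarith
  have hcl : DiffContOnCl ℂ g (ball a (r / 6)) :=
    (hg.mono (closure_ball_subset_closedBall.trans hsub)).diffContOnCl
  have := hcl.ball_subset_image_closedBall (by linarith) hlow
    (((hdiff a (mem_ball_self hr)).hasDerivAt.eventually_ne h0).frequently.filter_mono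
      nhdsWithin_le_nhds)
  refine Set.Subset.trans (ball_subset_ball (by linarith)) (this.trans (Set.image_mono hsub))

/-- Landau's trick: at a maximum `p` of `|g'(z)| (R/2 - |z - c|)`, with `s = R/2 - |p - c|`, one has
`|g'| ≤ 2|g'(p)|` on the ball of radius `s/2`. The image then contains a disc of radius `s|g'(p)| /
48`, which is at least `R|g'(c)| / 96`. -/
theorem norm_deriv_mul_le_of_not_ball_subset_image {g : ℂ → ℂ} {c : ℂ} {R ρ : ℝ} (hR : 0 < R)
    (hg : DifferentiableOn ℂ g (ball c R)) (hρ : ∀ w, ¬ ball w ρ ⊆ g '' ball c R) :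
    ‖deriv g c‖ * R ≤ 96 * ρ := by
  have hρ0 : 0 < ρ := by
    by_contra h
    exact hρ 0 (by simp [ball_eq_empty.2 (not_lt.1 h)])
  have hsub : closedBall c (R / 2) ⊆ ball c R := closedBall_subset_ball (by linarith)
  have hcont : ContinuousOn (fun z => ‖deriv g z‖ * (R / 2 - dist z c)) (closedBall c (R / 2)) := by
    have := ((hg.deriv isOpen_ball).mono hsub).continuousOn
    fun_prop
  obtain ⟨p, hp, hmax⟩ := (isCompact_closedBall c (R / 2)).exists_isMaxOn
    ⟨c, mem_closedBall_self (by linarith)⟩ hcont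
  have hc : ‖deriv g c‖ * (R / 2) ≤ ‖deriv g p‖ * (R / 2 - dist p c) := by
    simpa using hmax (mem_closedBall_self (x := c) (by linarith : 0 ≤ R / 2))
  rcases eq_or_ne (deriv g c) 0 with h0 | h0
  · rw [h0]; simp; linarith
  have h0' : 0 < ‖deriv g c‖ * (R / 2) := by
    have := norm_pos_iff.2 h0
    positivity
  have hs : 0 < R / 2 - dist p c := by
    by_contra h
    nlinarith [norm_nonneg (deriv g p)]
  have hp0 : deriv g p ≠ 0 := by
    rintro h
    rw [h] at hc
    simp at hc
    linarith
  set s := R / 2 - dist p c with hsdef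
  have hb : ball p (s / 2) ⊆ closedBall c (R / 2) := by
    apply ball_subset_closedBall.trans
    apply closedBall_subset_closedBall'
    linarith
  have := exists_ball_subset_image_of_norm_deriv_le (half_pos hs)
    (hg.mono (hb.trans hsub)) hp0 (fun z hz => by
      have h1 : ‖deriv g z‖ * (R / 2 - dist z c) ≤ ‖deriv g p‖ * s := hmax (hb hz)
      have h2 : s / 2 ≤ R / 2 - dist z c := by
        have := dist_triangle z p c
        rw [mem_ball] at hz
        linarith
      have h3 := mul_le_mul_of_nonneg_left h2 (norm_nonneg (deriv g z))
      have h4 : ‖deriv g z‖ * s ≤ 2 * ‖deriv g p‖ * s := by linarith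
      exact le_of_mul_le_mul_right h4 hs)
  by_contra hcon
  apply hρ (g p)
  refine (ball_subset_ball ?_).trans (this.trans (Set.image_mono (hb.trans hsub)))
  nlinarith

theorem exists_log_on_ball {f : ℂ → ℂ} {c : ℂ} {r : ℝ} (hf : DifferentiableOn ℂ f (ball c r))
    (h0 : ∀ z ∈ ball c r, f z ≠ 0) :
    ∃ L : ℂ → ℂ, DifferentiableOn ℂ L (ball c r) ∧ ∀ z ∈ ball c r, Complex.exp (L z) = f z := by
  rcases le_or_gt r 0 with hr | hr
  · refine ⟨0, differentiableOn_const 0, fun z hz => ?_⟩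
    simp [ball_eq_empty.2 hr] at hz
  have hc := mem_ball_self (x := c) hr
  -- `L` is the primitive of `f' / f` with `L c = log (f c)`; then `exp (-L) * f` has zero
  -- derivative and equals 1 at `c`.
  obtain ⟨L, hLc, hL⟩ := ((hf.deriv isOpen_ball).fun_div hf h0).isExactOn_ball.with_val_at c
    (Complex.log (f c))
  refine ⟨L, fun z hz => (hL z hz).differentiableAt.differentiableWithinAt, fun z hz => ?_⟩
  have hder (w : ℂ) (hw : w ∈ ball c r) :
      HasDerivAt (fun w => Complex.exp (-L w) * f w) 0 w := by
    have h1 := (hf.differentiableAt (isOpen_ball.mem_nhds hw)).hasDerivAt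
    refine (((hL w hw).fun_neg.cexp).fun_mul h1).congr_deriv ?_
    rw [mul_assoc, neg_mul, div_mul_cancel₀ _ (h0 w hw)]
    ring
  have hconst := (convex_ball c r).is_const_of_fderivWithin_eq_zero (𝕜 := ℂ)
    (f := fun w => Complex.exp (-L w) * f w)
    (fun w hw => (hder w hw).differentiableAt.differentiableWithinAt)
    (fun w hw => by
      rw [fderivWithin_of_isOpen isOpen_ball hw, ← toSpanSingleton_deriv, (hder w hw).deriv]
      simp) hz hc
  rw [hLc, Complex.exp_neg, Complex.exp_neg, Complex.exp_log (h0 c hc), inv_mul_cancel₀ (h0 c hc)]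
    at hconst
  rw [inv_mul_eq_one₀ (Complex.exp_ne_zero _)] at hconst
  exact hconst

theorem abs_re_le_norm_cosh (z : ℂ) : |z.re| ≤ ‖Complex.cosh z‖ := by
  have h1 : |Real.sinh z.re| ≤ ‖Complex.cosh z‖ := by
    have : Complex.cosh z = (Complex.exp z - -Complex.exp (-z)) / 2 := by
      rw [Complex.cosh]; ring
    rw [this, norm_div, Real.sinh_eq, abs_div]
    have h := abs_norm_sub_norm_le (Complex.exp z) (-Complex.exp (-z))
    rw [norm_neg, Complex.norm_exp, Complex.norm_exp, Complex.neg_re] at h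
    simp only [Complex.norm_ofNat, Nat.abs_ofNat]
    gcongr
  refine le_trans ?_ h1
  rcases le_total 0 z.re with h | h
  · rw [abs_of_nonneg h, abs_of_nonneg (Real.sinh_nonneg_iff.2 h)]
    exact Real.self_le_sinh_iff.2 h
  · rw [abs_of_nonpos h, abs_of_nonpos (Real.sinh_nonpos_iff.2 h), neg_le_neg_iff]
    exact Real.sinh_le_self_iff.2 h

theorem norm_cosh_le (z : ℂ) : ‖Complex.cosh z‖ ≤ Real.exp ‖z‖ := by
  rw [Complex.cosh, norm_div, Complex.norm_ofNat, div_le_iff₀ two_pos]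
  have h1 := Complex.norm_exp_le_exp_norm z
  have h2 := Complex.norm_exp_le_exp_norm (-z)
  rw [norm_neg] at h2
  linarith [norm_add_le (Complex.exp z) (Complex.exp (-z))]

theorem cosh_add_int_mul (z : ℂ) (k : ℤ) :
    Complex.cosh (z + k * (2 * Real.pi * Complex.I)) = Complex.cosh z := by
  rw [Complex.cosh, Complex.cosh, neg_add, Complex.exp_add, Complex.exp_add,
    Complex.exp_int_mul_two_pi_mul_I, Complex.exp_neg (k * _), Complex.exp_int_mul_two_pi_mul_I]
  simp

theorem exists_int_abs_sub_le (y : ℝ) : ∃ k : ℤ, |y + k * (2 * Real.pi)| ≤ 4 := by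
  refine ⟨-round (y / (2 * Real.pi)), ?_⟩
  have h := abs_sub_round (y / (2 * Real.pi))
  have hpi := Real.pi_pos
  have hpi4 := Real.pi_le_four
  have : y + ((-round (y / (2 * Real.pi)) : ℤ) : ℝ) * (2 * Real.pi) =
      (y / (2 * Real.pi) - round (y / (2 * Real.pi))) * (2 * Real.pi) := by
    push_cast; field_simp; ring
  rw [this, abs_mul, abs_of_pos (by positivity : 0 < 2 * Real.pi)]
  nlinarith

/-- A branch of arcosh: `g = log (φ + √(φ² - 1))`. The root exists because `φ² - 1` has no zeros,
and the argument of the outer logarithm is invertible with inverse `φ - √(φ² - 1)`. A shift by a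
period `2πik` makes `|Im g(c)| ≤ 4`, while `|Re g(c)| ≤ |cosh g(c)|`. -/
theorem exists_cosh_eq_on_ball {φ : ℂ → ℂ} {c : ℂ} {r : ℝ} (hr : 0 < r)
    (hφ : DifferentiableOn ℂ φ (ball c r)) (h1 : ∀ z ∈ ball c r, φ z ≠ 1)
    (h2 : ∀ z ∈ ball c r, φ z ≠ -1) :
    ∃ g : ℂ → ℂ, DifferentiableOn ℂ g (ball c r) ∧ (∀ z ∈ ball c r, Complex.cosh (g z) = φ z) ∧
      ‖g c‖ ≤ ‖φ c‖ + 4 := by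
  obtain ⟨L, hL, hLe⟩ := exists_log_on_ball (f := fun z => φ z ^ 2 - 1) (by fun_prop)
    (fun z hz h => by
      rcases mul_self_eq_one_iff.1 ((sq (φ z)).symm.trans (sub_eq_zero.1 h)) with h | h
      exacts [h1 z hz h, h2 z hz h])
  have hprod (z : ℂ) (hz : z ∈ ball c r) :
      (φ z + Complex.exp (L z / 2)) * (φ z - Complex.exp (L z / 2)) = 1 := by
    have : Complex.exp (L z / 2) * Complex.exp (L z / 2) = φ z ^ 2 - 1 := by
      rw [← Complex.exp_add, add_halves, hLe z hz]
    linear_combination -this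
  obtain ⟨g, hg, hge⟩ := exists_log_on_ball (f := fun z => φ z + Complex.exp (L z / 2))
    (by fun_prop) (fun z hz => left_ne_zero_of_mul_eq_one (hprod z hz))
  obtain ⟨k, hk⟩ := exists_int_abs_sub_le (g c).im
  have hcosh (z : ℂ) (hz : z ∈ ball c r) :
      Complex.cosh (g z + k * (2 * Real.pi * Complex.I)) = φ z := by
    rw [cosh_add_int_mul, Complex.cosh, Complex.exp_neg, hge z hz,
      inv_eq_of_mul_eq_one_right (hprod z hz)]
    ring
  refine ⟨fun z => g z + k * (2 * Real.pi * Complex.I), by fun_prop, hcosh, ?_⟩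
  refine (Complex.norm_le_abs_re_add_abs_im _).trans (add_le_add ?_ ?_)
  · rw [← hcosh c (mem_ball_self hr)]
    exact abs_re_le_norm_cosh _
  · simpa using hk

/-- On the real axis `cosh` grows by at least 1 over any step of length 2 away from 0, so it hits an
integer there; translating by the period `2πi` costs at most 4 vertically, and `2 + 4 < 7`. -/
theorem exists_cosh_eq_natCast (w : ℂ) : ∃ v ∈ ball w 7, ∃ n : ℕ, Complex.cosh v = n := by
  have key (x : ℝ) (hx : 0 ≤ x) : ∃ y : ℝ, |y - x| ≤ 2 ∧ ∃ n : ℕ, Real.cosh y = n := by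
    have h1 : Real.cosh x + 1 ≤ Real.cosh (x + 2) := by
      have h2 : Real.exp (-x) ≤ 1 := by simpa using hx
      have h3 : 0 < Real.exp (-(x + 2)) := Real.exp_pos _
      have h4 : 1 ≤ Real.exp x := by simpa using hx
      have h5 : 4 ≤ Real.exp 2 := by
        have h6 := Real.add_one_le_exp 1
        rw [show (2 : ℝ) = 1 + 1 by norm_num, Real.exp_add]
        nlinarith
      rw [Real.cosh_eq, Real.cosh_eq, Real.exp_add]
      nlinarith
    obtain ⟨y, hy, hyn⟩ := intermediate_value_Icc (by linarith : x ≤ x + 2)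
      Real.continuous_cosh.continuousOn (show (⌈Real.cosh x⌉₊ : ℝ) ∈ _ from
        ⟨Nat.le_ceil _, (Nat.ceil_lt_add_one (Real.cosh_pos x).le).le.trans h1⟩)
    exact ⟨y, by rw [abs_le]; constructor <;> linarith [hy.1, hy.2], _, hyn⟩
  have key2 (x : ℝ) : ∃ y : ℝ, |y - x| ≤ 2 ∧ ∃ n : ℕ, Real.cosh y = n := by
    rcases le_total 0 x with h | h
    · exact key x h
    · obtain ⟨y, hy, n, hn⟩ := key (-x) (by linarith)
      exact ⟨-y, by rw [← abs_neg]; convert hy using 2; ring, n, by rwa [Real.cosh_neg]⟩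
  obtain ⟨y, hy, n, hn⟩ := key2 w.re
  obtain ⟨k, hk⟩ := exists_int_abs_sub_le (-w.im)
  refine ⟨y + k * (2 * Real.pi * Complex.I), ?_, n, ?_⟩
  · rw [mem_ball, dist_eq_norm]
    refine (Complex.norm_le_abs_re_add_abs_im _).trans_lt ?_
    have e1 : (y + k * (2 * Real.pi * Complex.I) - w).re = y - w.re := by simp
    have e2 : (y + k * (2 * Real.pi * Complex.I) - w).im = -w.im + k * (2 * Real.pi) := by
      simp; ring
    rw [e1, e2]
    linarith
  · rw [cosh_add_int_mul, ← Complex.ofReal_cosh, hn]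
    simp

/-- Schottky's theorem. -/
theorem exists_norm_le_of_omits_zero_one : ∃ M : ℝ, 0 < M ∧ ∀ (h : ℂ → ℂ) (c : ℂ) (R : ℝ), 0 < R →
    DifferentiableOn ℂ h (ball c R) → (∀ z ∈ ball c R, h z ≠ 0) → (∀ z ∈ ball c R, h z ≠ 1) →
    ‖h c‖ ≤ 1 → ∀ z ∈ ball c (R / 2), ‖h z‖ ≤ M := by
  -- The bounds run `|g c| ≤ 3 + 4`, `|k c| ≤ 7 + 4`, `|k'| ≤ 96 * 7 / (R/2) = 1344/R`, so `|k z| ≤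
  -- 11 + 672`, generously rounded up to 2000. Applying `cosh` twice gives the double exponential.
  refine ⟨Real.exp (4 * Real.exp 2000) + 1, by positivity, ?_⟩
  intro h c R hR hh hh0 hh1 hc z hz
  have hcm := mem_ball_self (x := c) hR
  have hpi := Real.pi_pos
  have hpiI : (Real.pi * Complex.I : ℂ) ≠ 0 := by simp
  have npiI : ‖(Real.pi * Complex.I : ℂ)‖ = Real.pi := by simp [abs_of_pos hpi]
  obtain ⟨g, hg, hge, hgc⟩ := exists_cosh_eq_on_ball (φ := fun z => 2 * h z - 1) hR (by fun_prop)
    (fun z hz h1 => hh1 z hz (by linear_combination h1 / 2))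
    (fun z hz h1 => hh0 z hz (by linear_combination h1 / 2))
  -- If `g z = nπi`, then `2 h z - 1 = cos nπ = ±1`, so `h z` would be 0 or 1.
  have hgint (n : ℤ) (z : ℂ) (hz : z ∈ ball c R) : g z / (Real.pi * Complex.I) ≠ n := by
    intro h1
    have h2 : g z = n * Real.pi * Complex.I := by
      rw [div_eq_iff hpiI] at h1; rw [h1]; ring
    have h3 : (2 * h z - 1) ^ 2 = 1 := by
      rw [← hge z hz, h2, Complex.cosh_mul_I, ← Complex.ofReal_intCast, ← Complex.ofReal_mul,
        ← Complex.ofReal_cos, ← Complex.ofReal_pow, Real.cos_sq', Real.sin_int_mul_pi]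
      simp
    have h4 : h z * (h z - 1) = 0 := by linear_combination h3 / 4
    rcases mul_eq_zero.1 h4 with h5 | h5
    · exact hh0 z hz h5
    · exact hh1 z hz (sub_eq_zero.1 h5)
  obtain ⟨k, hk, hke, hkc⟩ := exists_cosh_eq_on_ball (φ := fun z => g z / (Real.pi * Complex.I)) hR
    (by fun_prop) (fun z hz => by simpa using hgint 1 z hz)
    (fun z hz => by simpa using hgint (-1) z hz)
  have hkder (w : ℂ) (hw : w ∈ ball c (R / 2)) : ‖deriv k w‖ ≤ 1344 / R := by
    have hsub : ball w (R / 2) ⊆ ball c R := by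
      apply ball_subset_ball'
      rw [mem_ball] at hw; linarith
    have := norm_deriv_mul_le_of_not_ball_subset_image (ρ := 7) (half_pos hR) (hk.mono hsub)
      (fun v hv => by
        obtain ⟨v', hv', n, hn⟩ := exists_cosh_eq_natCast v
        obtain ⟨z, hz, rfl⟩ := hv hv'
        rw [hke z (hsub hz)] at hn
        exact hgint n z (hsub hz) (by simpa using hn))
    rw [le_div_iff₀ hR]
    linarith
  have hkz : ‖k z - k c‖ ≤ 672 := by
    have h1 := (convex_ball c (R / 2)).norm_image_sub_le_of_norm_deriv_le (f := k)
      (fun w hw => hk.differentiableAt (isOpen_ball.mem_nhds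
        (ball_subset_ball (by linarith) hw))) hkder (mem_ball_self (half_pos hR)) hz
    refine h1.trans ?_
    rw [mem_ball, dist_eq_norm] at hz
    calc 1344 / R * ‖z - c‖ ≤ 1344 / R * (R / 2) := by gcongr
      _ = 672 := by field_simp; norm_num
  have hzR : z ∈ ball c R := ball_subset_ball (by linarith) hz
  have hgc' : ‖g c‖ ≤ 7 := by
    have : ‖2 * h c - 1‖ ≤ 3 := by
      refine (norm_sub_le _ _).trans ?_
      rw [norm_mul]; simp; linarith
    linarith
  have hkc' : ‖k c‖ ≤ 11 := by
    simp only [norm_div, npiI] at hkc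
    have : ‖g c‖ / Real.pi ≤ 7 := by
      rw [div_le_iff₀ hpi]; nlinarith [Real.pi_gt_three]
    linarith
  have hkz' : ‖k z‖ ≤ 2000 := by
    have := norm_add_le (k z - k c) (k c)
    rw [sub_add_cancel] at this
    linarith
  have hgz : ‖g z‖ ≤ 4 * Real.exp 2000 := by
    have h1 : g z = Real.pi * Complex.I * Complex.cosh (k z) := by
      rw [hke z hzR]; field_simp
    rw [h1, norm_mul, npiI]
    gcongr
    · exact Real.pi_le_four
    · exact (norm_cosh_le _).trans (Real.exp_le_exp.2 hkz')
  have h1 : h z = (Complex.cosh (g z) + 1) / 2 := by rw [hge z hzR]; ring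
  have h2 := (norm_cosh_le (g z)).trans (Real.exp_le_exp.2 hgz)
  rw [h1, norm_div, Complex.norm_ofNat, div_le_iff₀ two_pos]
  have h3 := norm_add_le (Complex.cosh (g z)) 1
  rw [norm_one] at h3
  have := Real.exp_pos (4 * Real.exp 2000)
  linarith

/-- A quantitative form of Montel's theorem for holomorphic functions that omit `0` and `1`. -/
theorem exists_sphericalDist_le_of_omits_zero_one : ∃ C : ℝ, 0 < C ∧ ∀ (h : ℂ → ℂ) (c : ℂ) (R : ℝ),
    0 < R → DifferentiableOn ℂ h (ball c R) → (∀ z ∈ ball c R, h z ≠ 0) →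
    (∀ z ∈ ball c R, h z ≠ 1) →
    ∀ z ∈ ball c (R / 2), sphericalDist (h z) (h c) ≤ C / R * ‖z - c‖ := by
  obtain ⟨M, hM, H⟩ := exists_norm_le_of_omits_zero_one
  have key (h : ℂ → ℂ) (c : ℂ) (R : ℝ) (hR : 0 < R) (hd : DifferentiableOn ℂ h (ball c R))
      (h0 : ∀ z ∈ ball c R, h z ≠ 0) (h1 : ∀ z ∈ ball c R, h z ≠ 1) (hc : ‖h c‖ ≤ 1)
      (z : ℂ) (hz : z ∈ ball c (R / 2)) : sphericalDist (h z) (h c) ≤ 8 * M / R * ‖z - c‖ := by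
    have hb := H h c R hR hd h0 h1 hc
    have hmaps : Set.MapsTo h (ball c (R / 2)) (closedBall (h c) (2 * M)) := by
      intro w hw
      rw [mem_closedBall, dist_eq_norm]
      linarith [norm_sub_le (h w) (h c), hb w hw, hb c (mem_ball_self (half_pos hR))]
    have h2 := Complex.dist_le_div_mul_dist_of_mapsTo_ball
      (hd.mono (ball_subset_ball (by linarith))) hmaps hz
    rw [dist_eq_norm, dist_eq_norm] at h2
    refine (sphericalDist_coe_le _ _).trans ?_
    calc 2 * ‖h z - h c‖ ≤ 2 * (2 * M / (R / 2) * ‖z - c‖) := by gcongr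
      _ = _ := by field_simp; ring
  refine ⟨8 * M, by positivity, fun h c R hR hd h0 h1 z hz => ?_⟩
  have hcm := mem_ball_self (x := c) hR
  have hzR : z ∈ ball c R := ball_subset_ball (by linarith) hz
  rcases le_total ‖h c‖ 1 with hc | hc
  · exact key h c R hR hd h0 h1 hc z hz
  -- `1/h` omits the same two values, and inversion is a chordal isometry.
  · rw [← sphericalDist_inv (h0 z hzR) (h0 c hcm)]
    refine key (fun z => (h z)⁻¹) c R hR (hd.inv h0) (fun z hz => inv_ne_zero (h0 z hz))
      (fun z hz => by simpa using h1 z hz) ?_ z hz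
    rw [norm_inv]
    exact inv_le_one_of_one_le₀ hc

end Schottky

/-! ### Normality, equicontinuity and invariance of the Julia set -/

section Normality

open Filter Topology Metric

attribute [local instance] sphereMetricSpace

theorem IsNormalFamilyOn.equicontinuousAt {ι : Type*} {F : ι → OnePoint ℂ → OnePoint ℂ}
    {U : Set (OnePoint ℂ)} (h : IsNormalFamilyOn F U) (hF : ∀ i, Continuous (F i)) (hU : IsOpen U)
    {x : OnePoint ℂ} (hx : x ∈ U) : EquicontinuousAt F x := by
  rw [Metric.equicontinuousAt_iff]
  by_contra! hcon
  obtain ⟨ε, hε, hcon⟩ := hcon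
  obtain ⟨r, hr, hrU⟩ := Metric.isOpen_iff.1 hU x hx
  choose y hy a ha using fun n : ℕ => hcon (min r (1 / (n + 1))) (by positivity)
  have hyx : Tendsto y atTop (𝓝 x) := by
    rw [tendsto_iff_dist_tendsto_zero]
    exact squeeze_zero (fun _ => dist_nonneg) (fun n => ((hy n).trans_le (min_le_right _ _)).le)
      tendsto_one_div_add_atTop_nhds_zero_nat
  -- The bad points `y n` and their limit `x` form a compact set, where the subsequence is uniformly
  -- close to `g`. Comparison through the single continuous map `F (a (k N))` takes five steps of
  -- size `ε/5` and needs no continuity of `g`.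
  obtain ⟨k, hk, g, hg⟩ := h a
  obtain ⟨N, hN⟩ := hg (insert x (Set.range y)) (by
    rintro z (rfl | ⟨n, rfl⟩)
    · exact hx
    · exact hrU ((hy n).trans_le (min_le_left _ _))) hyx.isCompact_insert_range (ε / 5)
      (by positivity)
  have hcont := Metric.tendsto_nhds.1 (((hF (a (k N))).tendsto x).comp
    (hyx.comp hk.tendsto_atTop)) (ε / 5) (by positivity)
  obtain ⟨n, hn, hnN⟩ := (hcont.and (eventually_ge_atTop N)).exists
  have h1 := hN n hnN x (Set.mem_insert _ _)
  have h2 := hN N le_rfl x (Set.mem_insert _ _)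
  have h3 := hN n hnN (y (k n)) (Set.mem_insert_of_mem _ ⟨_, rfl⟩)
  have h4 := hN N le_rfl (y (k n)) (Set.mem_insert_of_mem _ ⟨_, rfl⟩)
  rw [← sphere_dist_eq] at h1 h2 h3 h4
  have h5 := ha (k n)
  simp only [Function.comp_apply] at hn
  have t1 := dist_triangle4 (F (a (k n)) x) (g x) (F (a (k N)) x) (F (a (k N)) (y (k n)))
  have t2 := dist_triangle4 (F (a (k n)) x) (F (a (k N)) (y (k n))) (g (y (k n)))
    (F (a (k n)) (y (k n)))
  rw [dist_comm] at h2 hn h3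
  linarith

theorem isNormalFamilyOn_of_equicontinuousAt {ι : Type*} {F : ι → OnePoint ℂ → OnePoint ℂ}
    {U : Set (OnePoint ℂ)} (h : ∀ x ∈ U, EquicontinuousAt F x) :
    IsNormalFamilyOn F U := by
  intro a
  -- The diagonal argument: compactness of the countable product gives convergence at all points of
  -- a dense sequence at once.
  obtain ⟨l, k, hk, hl⟩ := CompactSpace.tendsto_subseq
    (fun n m => F (a n) (TopologicalSpace.denseSeq (OnePoint ℂ) m))
  rw [tendsto_pi_nhds] at hl
  have hcauchy (K : Set (OnePoint ℂ)) (hKU : K ⊆ U) (hK : IsCompact K) (ε : ℝ) (hε : 0 < ε) :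
      ∃ N : ℕ, ∀ n ≥ N, ∀ m ≥ N, ∀ z ∈ K, dist (F (a (k n)) z) (F (a (k m)) z) < ε := by
    refine hK.induction_on (p := fun K => ∃ N : ℕ, ∀ n ≥ N, ∀ m ≥ N, ∀ z ∈ K,
      dist (F (a (k n)) z) (F (a (k m)) z) < ε) ⟨0, by simp⟩ ?_ ?_ ?_
    · rintro s t hst ⟨N, hN⟩
      exact ⟨N, fun n hn m hm z hz => hN n hn m hm z (hst hz)⟩
    · rintro s t ⟨N, hN⟩ ⟨M, hM⟩
      refine ⟨max N M, fun n hn m hm z hz => ?_⟩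
      rcases hz with hz | hz
      · exact hN n ((le_max_left _ _).trans hn) m ((le_max_left _ _).trans hm) z hz
      · exact hM n ((le_max_right _ _).trans hn) m ((le_max_right _ _).trans hm) z hz
    · intro x hx
      obtain ⟨δ, hδ, H⟩ := Metric.equicontinuousAt_iff.1 (h x (hKU hx)) (ε / 6) (by positivity)
      obtain ⟨j, hj⟩ := (TopologicalSpace.denseRange_denseSeq (OnePoint ℂ)).exists_dist_lt x hδ
      rw [dist_comm] at hj
      obtain ⟨N, hN⟩ := Metric.cauchySeq_iff.1 (hl j).cauchySeq (ε / 6) (by positivity)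
      refine ⟨ball x δ, mem_nhdsWithin_of_mem_nhds (ball_mem_nhds x hδ), N,
        fun n hn m hm z hz => ?_⟩
      have h1 := H z hz (a (k n))
      have h2 := H z hz (a (k m))
      have h3 := H _ hj (a (k n))
      have h4 := H _ hj (a (k m))
      have h5 := hN n hn m hm
      simp only [Function.comp_apply] at h5
      rw [dist_comm] at h1 h4
      have t1 := dist_triangle4 (F (a (k n)) z) (F (a (k n)) x)
        (F (a (k n)) (TopologicalSpace.denseSeq (OnePoint ℂ) j))
        (F (a (k m)) (TopologicalSpace.denseSeq (OnePoint ℂ) j))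
      have t2 := dist_triangle4 (F (a (k n)) z)
        (F (a (k m)) (TopologicalSpace.denseSeq (OnePoint ℂ) j)) (F (a (k m)) x)
        (F (a (k m)) z)
      linarith
  have hlim (z : OnePoint ℂ) : ∃ w, z ∈ U → Tendsto (fun n => F (a (k n)) z) atTop (𝓝 w) := by
    by_cases hz : z ∈ U
    · have : CauchySeq (fun n => F (a (k n)) z) := by
        rw [Metric.cauchySeq_iff]
        intro ε hε
        obtain ⟨N, hN⟩ := hcauchy {z} (by simpa using hz) isCompact_singleton ε hε
        exact ⟨N, fun n hn m hm => hN n hn m hm z rfl⟩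
      obtain ⟨w, hw⟩ := cauchySeq_tendsto_of_complete this
      exact ⟨w, fun _ => hw⟩
    · exact ⟨∞, fun h => absurd h hz⟩
  choose g hg using hlim
  refine ⟨k, hk, g, fun K hKU hK ε hε => ?_⟩
  obtain ⟨N, hN⟩ := hcauchy K hKU hK (ε / 2) (half_pos hε)
  refine ⟨N, fun n hn z hz => ?_⟩
  rw [← sphere_dist_eq]
  have : dist (F (a (k n)) z) (g z) ≤ ε / 2 := by
    refine le_of_tendsto (tendsto_const_nhds.dist (hg z (hKU hz))) ?_
    filter_upwards [eventually_ge_atTop N] with m hm using (hN n hn m hm z hz).le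
  linarith

theorem mem_fatouSet_iff {f : OnePoint ℂ → OnePoint ℂ} (hf : Continuous f) {x : OnePoint ℂ} :
    x ∈ fatouSet f ↔ ∀ᶠ y in 𝓝 x, EquicontinuousAt (fun n : ℕ => f^[n]) y := by
  constructor
  · rintro ⟨U, ⟨hU, hn⟩, hx⟩
    filter_upwards [hU.mem_nhds hx] with y hy using
      hn.equicontinuousAt (fun n => hf.iterate n) hU hy
  · intro h
    obtain ⟨U, hUs, hU, hx⟩ := _root_.mem_nhds_iff.1 h
    exact ⟨U, ⟨hU, isNormalFamilyOn_of_equicontinuousAt hUs⟩, hx⟩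

/-- Since `f^[n] ∘ f = f^[n+1]`, the families at `f x` and `x` differ only by the identity;
continuity pulls neighbourhoods back and openness pushes them forward. -/
theorem equicontinuousAt_iterate_apply_iff {f : OnePoint ℂ → OnePoint ℂ} (hf : Continuous f)
    (ho : IsOpenMap f) (x : OnePoint ℂ) :
    EquicontinuousAt (fun n : ℕ => f^[n]) (f x) ↔ EquicontinuousAt (fun n : ℕ => f^[n]) x := by
  constructor
  · intro h U hU
    filter_upwards [hf.tendsto x (h U hU), (tendsto_id (x := 𝓝 x)).eventually
      (UniformSpace.ball_mem_nhds x hU)] with y hy hy' n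
    cases n with
    | zero => exact hy'
    | succ n => exact hy n
  · intro h U hU
    have := ho.image_mem_nhds (h U hU)
    filter_upwards [this]
    rintro _ ⟨y, hy, rfl⟩ n
    exact hy (n + 1)

theorem apply_mem_fatouSet_iff {f : OnePoint ℂ → OnePoint ℂ} (hf : Continuous f)
    (ho : IsOpenMap f) (x : OnePoint ℂ) : f x ∈ fatouSet f ↔ x ∈ fatouSet f := by
  rw [mem_fatouSet_iff hf, mem_fatouSet_iff hf, ← IsOpenMap.map_nhds_eq ho hf.continuousAt, eventually_map]
  simp only [equicontinuousAt_iterate_apply_iff hf ho]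

theorem isClosed_juliaSet (f : OnePoint ℂ → OnePoint ℂ) : IsClosed (juliaSet f) :=
  (isOpen_sUnion fun _ h => h.1).isClosed_compl

theorem isCompletelyInvariant_juliaSet {f : OnePoint ℂ → OnePoint ℂ} (hf : Continuous f)
    (ho : IsOpenMap f) (hs : Function.Surjective f) : IsCompletelyInvariant f (juliaSet f) := by
  have h : f ⁻¹' juliaSet f = juliaSet f := by
    ext x
    exact not_congr (apply_mem_fatouSet_iff hf ho x)
  refine ⟨?_, h⟩
  conv_lhs => rw [← h]
  exact Set.image_preimage_eq _ hs

end Normality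

/-! ### Homogeneous lifts of rational maps; surjectivity and openness -/

section Lift

open Filter Topology

attribute [local instance] sphereMetricSpace

/-- `F` is a homogeneous polynomial map of degree `d` of `ℂ²` that induces the map `f` of the
Riemann sphere. -/
structure IsHomogeneousLift (F : ℂ × ℂ → ℂ × ℂ) (d : ℕ) (f : OnePoint ℂ → OnePoint ℂ) : Prop where
  continuous : Continuous F
  exists_polynomial (p q : ℂ[X]) :
    ∃ p' q' : ℂ[X], ∀ s : ℂ, F (p.eval s, q.eval s) = (p'.eval s, q'.eval s)
  map_smul (t : ℂ) (v : ℂ × ℂ) : F (t • v) = t ^ d • F v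
  map_ne_zero {v : ℂ × ℂ} (hv : v ≠ 0) : F v ≠ 0
  apply_toSphere {v : ℂ × ℂ} (hv : v ≠ 0) : f (toSphere v) = toSphere (F v)

/-- The homogenization of degree `d` of the polynomial `p`. -/
def homogeneousEval (d : ℕ) (p : ℂ[X]) (v : ℂ × ℂ) : ℂ :=
  ∑ j ∈ Finset.range (d + 1), p.coeff j * v.1 ^ j * v.2 ^ (d - j)

theorem homogeneousEval_smul (d : ℕ) (p : ℂ[X]) (t : ℂ) (v : ℂ × ℂ) :
    homogeneousEval d p (t • v) = t ^ d * homogeneousEval d p v := by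
  unfold homogeneousEval
  rw [Finset.mul_sum]
  refine Finset.sum_congr rfl fun j hj => ?_
  have h : t ^ d = t ^ j * t ^ (d - j) := by
    rw [← pow_add, Nat.add_sub_cancel' (Nat.lt_succ_iff.1 (Finset.mem_range.1 hj))]
  simp only [Prod.smul_fst, Prod.smul_snd, smul_eq_mul, mul_pow, h]
  ring

theorem homogeneousEval_mk_one {d : ℕ} {p : ℂ[X]} (hp : p.natDegree ≤ d) (z : ℂ) :
    homogeneousEval d p (z, 1) = p.eval z := by
  rw [Polynomial.eval_eq_sum_range' (Nat.lt_succ_of_le hp)]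
  simp [homogeneousEval]

theorem homogeneousEval_one_zero (d : ℕ) (p : ℂ[X]) : homogeneousEval d p (1, 0) = p.coeff d := by
  unfold homogeneousEval
  rw [Finset.sum_eq_single d]
  · simp
  · intro j hj hjd
    have : d - j ≠ 0 := by
      have := Finset.mem_range.1 hj
      omega
    simp [this]
  · simp

theorem eq_smul_mk_one {v : ℂ × ℂ} (hv : v.2 ≠ 0) : v = v.2 • (v.1 / v.2, (1 : ℂ)) :=
  Prod.ext (by simp [mul_div_cancel₀ _ hv]) (by simp)

theorem eq_smul_one_zero {v : ℂ × ℂ} (hv : v.2 = 0) : v = v.1 • ((1 : ℂ), (0 : ℂ)) :=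
  Prod.ext (by simp) (by simp [hv])

theorem exists_isHomogeneousLift_ratMap (R : RatFunc ℂ) :
    ∃ F, IsHomogeneousLift F (ratDegree R) (ratMap R) := by
  set d := ratDegree R with hd
  have hP : R.num.natDegree ≤ d := le_max_left _ _
  have hQ : R.denom.natDegree ≤ d := le_max_right _ _
  set F : ℂ × ℂ → ℂ × ℂ := fun v => (homogeneousEval d R.num v, homogeneousEval d R.denom v) with hF
  have hsmul (t : ℂ) (v : ℂ × ℂ) : F (t • v) = t ^ d • F v :=
    Prod.ext (homogeneousEval_smul _ _ _ _) (homogeneousEval_smul _ _ _ _)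
  have hF1 (z : ℂ) : F (z, 1) = (R.num.eval z, R.denom.eval z) :=
    Prod.ext (homogeneousEval_mk_one hP z) (homogeneousEval_mk_one hQ z)
  have hF0 : F (1, 0) = (R.num.coeff d, R.denom.coeff d) :=
    Prod.ext (homogeneousEval_one_zero _ _) (homogeneousEval_one_zero _ _)
  have hF1ne (z : ℂ) : F (z, 1) ≠ 0 := by
    rw [hF1]
    intro h
    obtain ⟨a, b, hab⟩ := R.isCoprime_num_denom
    have h1 : R.num.eval z = 0 := congrArg Prod.fst h
    have h2 : R.denom.eval z = 0 := congrArg Prod.snd h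
    have := congrArg (Polynomial.eval z) hab
    simp [h1, h2] at this
  have hlead : R.denom.natDegree = d → R.denom.coeff d ≠ 0 := fun h => by
    rw [← h]; exact Polynomial.leadingCoeff_ne_zero.2 R.denom_ne_zero
  have hF0ne : F (1, 0) ≠ 0 := by
    rw [hF0]
    intro h
    have h1 : R.num.coeff d = 0 := congrArg Prod.fst h
    have h2 : R.denom.coeff d = 0 := congrArg Prod.snd h
    rcases max_choice R.num.natDegree R.denom.natDegree with h3 | h3
    -- Here the numerator has the maximal degree, so it must be 0. Then the denominator is 1 and `d
    -- = 0`, and the denominator's coefficient is the nonzero one.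
    · rw [hd, ratDegree, h3] at h1
      have h4 : R.num = 0 := Polynomial.leadingCoeff_eq_zero.1 h1
      have h5 : R.denom.natDegree = d := by
        rw [RatFunc.num_eq_zero_iff.1 h4] at hd ⊢
        simp [ratDegree] at hd ⊢
        exact hd.symm
      exact hlead h5 h2
    · exact hlead h3.symm h2
  have hmap1 (z : ℂ) : ratMap R z = toSphere (F (z, 1)) := by
    rw [hF1]; rfl
  have hmap0 : ratMap R ∞ = toSphere (F (1, 0)) := by
    rw [hF0]
    change (if R.denom.natDegree < R.num.natDegree then ∞
      else ((R.num.coeff R.denom.natDegree / R.denom.leadingCoeff : ℂ) : OnePoint ℂ)) = _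
    split_ifs with h
    · have : R.denom.coeff d = 0 :=
        Polynomial.coeff_eq_zero_of_natDegree_lt (h.trans_le hP)
      simp [toSphere, this]
    · have h1 : R.denom.natDegree = d := (max_eq_right (not_lt.1 h)).symm
      have h2 := hlead h1
      simp [toSphere, h2, Polynomial.leadingCoeff, h1]
  have hcont : Continuous F := by
    simp only [hF]
    unfold homogeneousEval
    fun_prop
  refine ⟨F, hcont, fun p q => ?_, hsmul, fun {v} hv => ?_, fun {v} hv => ?_⟩
  · refine ⟨∑ j ∈ Finset.range (d + 1), C (R.num.coeff j) * p ^ j * q ^ (d - j),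
      ∑ j ∈ Finset.range (d + 1), C (R.denom.coeff j) * p ^ j * q ^ (d - j), fun s => ?_⟩
    simp [hF, homogeneousEval, Polynomial.eval_finsetSum]
  · by_cases h : v.2 = 0
    · have h1 : v.1 ≠ 0 := fun h1 => hv (Prod.ext h1 h)
      rw [eq_smul_one_zero h, hsmul]
      exact smul_ne_zero (pow_ne_zero _ h1) hF0ne
    · rw [eq_smul_mk_one h, hsmul]
      exact smul_ne_zero (pow_ne_zero _ h) (hF1ne _)
  · by_cases h : v.2 = 0
    · have h1 : v.1 ≠ 0 := fun h1 => hv (Prod.ext h1 h)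
      rw [eq_smul_one_zero h, hsmul, toSphere_smul h1, toSphere_smul (pow_ne_zero _ h1),
        toSphere_infty, hmap0]
    · rw [eq_smul_mk_one h, hsmul, toSphere_smul h, toSphere_smul (pow_ne_zero _ h),
        toSphere_coe, hmap1]

/-- A vector orthogonal to `u` of the same length. -/
def perp (u : ℂ × ℂ) : ℂ × ℂ := (-star u.2, star u.1)

theorem herm_self (u : ℂ × ℂ) : herm u u = ((euclNorm u ^ 2 : ℝ) : ℂ) := by
  rw [euclNorm_sq, herm, Complex.star_def, Complex.mul_conj, Complex.mul_conj,
    Complex.normSq_eq_norm_sq, Complex.normSq_eq_norm_sq]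
  push_cast; ring

theorem herm_self_ne_zero {u : ℂ × ℂ} (hu : u ≠ 0) : herm u u ≠ 0 := by
  rw [herm_self, Complex.ofReal_ne_zero]
  exact pow_ne_zero _ (euclNorm_pos hu).ne'

/-- Coordinates in the orthogonal basis `u`, `perp u`. The quotient `wedge u v / herm v u` is then
an affine coordinate near `toSphere u`, omitting only the antipode `toSphere (perp u)`. -/
theorem herm_self_smul (u v : ℂ × ℂ) : herm u u • v = herm v u • u + wedge u v • perp u := by
  ext <;> simp [wedge, perp, herm] <;> ring

theorem exists_eq_smul_add_smul_perp {u : ℂ × ℂ} (hu : u ≠ 0) (v : ℂ × ℂ) :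
    ∃ a : ℂ, v = a • u + (wedge u v / herm u u) • perp u := by
  refine ⟨herm v u / herm u u, ?_⟩
  have h := congrArg (fun w => (herm u u)⁻¹ • w) (herm_self_smul u v)
  simp only [smul_add, smul_smul, inv_mul_cancel₀ (herm_self_ne_zero hu), one_smul] at h
  rwa [div_eq_inv_mul, div_eq_inv_mul]

theorem wedge_smul_add_perp (u : ℂ × ℂ) (a b : ℂ) :
    wedge u (a • u + b • perp u) = b * herm u u := by
  simp [wedge, perp, herm]; ring

theorem smul_add_perp_ne_zero {u : ℂ × ℂ} (hu : u ≠ 0) (s : ℂ) : s • u + perp u ≠ 0 := by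
  intro h
  have := wedge_smul_add_perp u s 1
  rw [one_smul, h, one_mul] at this
  exact herm_self_ne_zero hu (by simpa [wedge] using this.symm)

theorem add_smul_perp_ne_zero {u : ℂ × ℂ} (hu : u ≠ 0) (t : ℂ) : u + t • perp u ≠ 0 := by
  intro h
  have := herm_self_ne_zero hu
  have h1 : herm (u + t • perp u) u = herm u u := by simp [herm, perp]; ring
  rw [h] at h1
  exact this (by simpa [herm] using h1.symm)

theorem toSphere_eq_add_smul_perp {u v : ℂ × ℂ} (hu : u ≠ 0) (hv : herm v u ≠ 0) :
    toSphere v = toSphere (u + (wedge u v / herm v u) • perp u) := by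
  have h := herm_self_smul u v
  rw [← toSphere_smul (herm_self_ne_zero hu) v, h,
    ← toSphere_smul hv (u + (wedge u v / herm v u) • perp u), smul_add, smul_smul,
    mul_div_cancel₀ _ hv]

theorem continuous_toSphere_add_smul_perp {u : ℂ × ℂ} (hu : u ≠ 0) :
    Continuous fun t : ℂ => toSphere (u + t • perp u) := by
  rw [continuous_iff_continuousAt]
  intro t
  exact (continuousAt_toSphere (add_smul_perp_ne_zero hu t)).comp
    (f := fun t : ℂ => u + t • perp u) (by fun_prop)

theorem nhds_toSphere_le_map {u : ℂ × ℂ} (hu : u ≠ 0) :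
    𝓝 (toSphere u) ≤ map (fun t : ℂ => toSphere (u + t • perp u)) (𝓝 0) := by
  have hcontherm : Continuous fun v => herm v u := by unfold herm; fun_prop
  have hcont : ContinuousAt (fun v => wedge u v / herm v u) u := by
    apply ContinuousAt.div
    · unfold wedge; fun_prop
    · exact hcontherm.continuousAt
    · exact herm_self_ne_zero hu
  rw [← nhds_toSphere hu]
  have h1 : toSphere =ᶠ[𝓝 u]
      (fun t : ℂ => toSphere (u + t • perp u)) ∘ fun v => wedge u v / herm v u := by
    filter_upwards [hcontherm.continuousAt.eventually_ne (herm_self_ne_zero hu)] with v hv using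
      toSphere_eq_add_smul_perp hu hv
  rw [Filter.map_congr h1, ← map_map]
  apply map_mono
  have h2 := hcont.tendsto
  rwa [wedge_self, zero_div] at h2

namespace IsHomogeneousLift

variable {F G : ℂ × ℂ → ℂ × ℂ} {d e : ℕ} {f g : OnePoint ℂ → OnePoint ℂ}

protected theorem id : IsHomogeneousLift id 1 id :=
  ⟨continuous_id, fun p q => ⟨p, q, fun _ => rfl⟩, by simp, fun h => h, fun _ => rfl⟩

theorem comp (hF : IsHomogeneousLift F d f) (hG : IsHomogeneousLift G e g) :
    IsHomogeneousLift (F ∘ G) (e * d) (f ∘ g) where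
  continuous := hF.continuous.comp hG.continuous
  exists_polynomial p q := by
    obtain ⟨p', q', h⟩ := hG.exists_polynomial p q
    obtain ⟨p'', q'', h'⟩ := hF.exists_polynomial p' q'
    exact ⟨p'', q'', fun s => by rw [Function.comp_apply, h, h']⟩
  map_smul t v := by simp only [Function.comp_apply, hG.map_smul, hF.map_smul, pow_mul]
  map_ne_zero hv := hF.map_ne_zero (hG.map_ne_zero hv)
  apply_toSphere hv := by
    simp only [Function.comp_apply, hG.apply_toSphere hv, hF.apply_toSphere (hG.map_ne_zero hv)]

theorem iterate (hF : IsHomogeneousLift F d f) (n : ℕ) :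
    IsHomogeneousLift F^[n] (d ^ n) f^[n] := by
  induction n with
  | zero => exact IsHomogeneousLift.id
  | succ n ih =>
    rw [Function.iterate_succ, Function.iterate_succ, pow_succ, mul_comm]
    exact ih.comp hF

theorem continuous_map (hF : IsHomogeneousLift F d f) : Continuous f := by
  rw [continuous_iff_continuousAt]
  intro x
  obtain ⟨u, hu, rfl⟩ := exists_toSphere_eq x
  rw [ContinuousAt, ← nhds_toSphere hu, tendsto_map'_iff, hF.apply_toSphere hu]
  refine ((continuousAt_toSphere (hF.map_ne_zero hu)).comp hF.continuous.continuousAt).tendsto.congr'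
    ?_
  filter_upwards [isOpen_ne.mem_nhds hu] with v hv using (hF.apply_toSphere hv).symm

/-- Polynomiality of a lift is used only through restriction to lines; stated along polynomial
curves, it survives composition and hence iteration. -/
theorem exists_polynomial_line (hF : IsHomogeneousLift F d f) (u w : ℂ × ℂ) :
    ∃ p q : ℂ[X], ∀ s : ℂ, F (u + s • w) = (p.eval s, q.eval s) := by
  obtain ⟨p, q, h⟩ := hF.exists_polynomial (C u.1 + X * C w.1) (C u.2 + X * C w.2)
  refine ⟨p, q, fun s => ?_⟩
  rw [← h]
  congr 1
  ext <;> simp <;> ring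

/-- A polynomial in `s` without zeros is constant; homogeneity spreads this to `b ≠ 0` and
continuity to `b = 0`. It applies when the fibre over `Y` contains at most the point of `u`. -/
theorem wedge_apply_eq (hF : IsHomogeneousLift F d f) {Y u w : ℂ × ℂ}
    (h : ∀ s : ℂ, wedge Y (F (s • u + w)) ≠ 0) :
    ∃ c, ∀ a b : ℂ, wedge Y (F (a • u + b • w)) = c * b ^ d := by
  obtain ⟨p, q, hpq⟩ := hF.exists_polynomial_line w u
  set k : ℂ[X] := C Y.1 * q - C Y.2 * p with hk
  have hke (s : ℂ) : k.eval s = wedge Y (F (s • u + w)) := by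
    rw [add_comm, hpq]; simp [hk, wedge]
  have hdeg : k.degree ≤ 0 := by
    by_contra hdeg
    obtain ⟨s, hs⟩ := IsAlgClosed.exists_root k (fun h0 => hdeg h0.le)
    exact h s (by rw [← hke]; exact hs)
  rw [Polynomial.eq_C_of_degree_le_zero hdeg] at hke
  simp only [eval_C] at hke
  refine ⟨k.coeff 0, fun a b => ?_⟩
  have key : Set.EqOn (fun b : ℂ => wedge Y (F (a • u + b • w))) (fun b => k.coeff 0 * b ^ d)
      {0}ᶜ := by
    intro b hb
    have hb : b ≠ 0 := hb
    have e : a • u + b • w = b • ((a / b) • u + w) := by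
      rw [smul_add, smul_smul, mul_div_cancel₀ _ hb]
    simp only
    rw [e, hF.map_smul, wedge_smul_right, ← hke, mul_comm]
  have hc := hF.continuous
  exact congrFun (Continuous.ext_on (dense_compl_singleton (0 : ℂ)) (by unfold wedge; fun_prop)
    (by fun_prop) key) b

theorem surjective (hF : IsHomogeneousLift F d f) (hd : d ≠ 0) : Function.Surjective f := by
  intro y
  obtain ⟨Y, hY, rfl⟩ := exists_toSphere_eq y
  by_contra! hcon
  have h10 : ((1 : ℂ), (0 : ℂ)) ≠ 0 := by simp
  have key {v : ℂ × ℂ} (hv : v ≠ 0) : wedge Y (F v) ≠ 0 := fun h0 => by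
    rw [wedge_eq_zero_iff hY (hF.map_ne_zero hv), ← hF.apply_toSphere hv] at h0
    exact hcon _ h0.symm
  obtain ⟨c, hc⟩ := hF.wedge_apply_eq (Y := Y) (u := (1, 0)) (w := perp (1, 0))
    (fun s => key (smul_add_perp_ne_zero h10 s))
  -- At `b = 0` the form `c * b ^ d` vanishes, since `d ≠ 0`.
  apply key h10
  simpa [hd] using hc 1 0

theorem isOpenMap (hF : IsHomogeneousLift F d f) (hd : d ≠ 0) : IsOpenMap f := by
  rw [isOpenMap_iff_nhds_le]
  intro x
  obtain ⟨u, hu, rfl⟩ := exists_toSphere_eq x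
  set U := F u with hUdef
  have hU : U ≠ 0 := hF.map_ne_zero hu
  obtain ⟨p, q, hpq⟩ := hF.exists_polynomial_line u (perp u)
  set line : ℂ → OnePoint ℂ := fun t => toSphere (u + t • perp u)
  set target : ℂ → OnePoint ℂ := fun t => toSphere (U + t • perp U)
  set slope : ℂ × ℂ → ℂ := fun V => wedge U V / herm V U with hslope
  have hhermU : herm U U ≠ 0 := herm_self_ne_zero hU
  have hslopeU : slope U = 0 := by simp [hslope, wedge_self]
  have hcontherm : Continuous fun V => herm V U := by unfold herm; fun_prop
  have hline : Tendsto line (𝓝 0) (𝓝 (toSphere u)) := by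
    simpa [line] using (continuous_toSphere_add_smul_perp hu).tendsto 0
  have hne : ∀ᶠ V in 𝓝 U, herm V U ≠ 0 := hcontherm.continuousAt.eventually_ne hhermU
  have htarget : 𝓝 (toSphere U) ≤ map target (𝓝 0) := nhds_toSphere_le_map hU
  set φ : ℂ → ℂ := fun t => slope (F (u + t • perp u)) with hφ
  have hFc : Continuous fun t : ℂ => F (u + t • perp u) := hF.continuous.comp (by fun_prop)
  have hF0 : F (u + (0 : ℂ) • perp u) = U := by simp [hUdef]
  have hφ0 : φ 0 = 0 := by simp only [hφ]; rw [hF0, hslopeU]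
  have hne' : ∀ᶠ t in 𝓝 (0 : ℂ), herm (F (u + t • perp u)) U ≠ 0 := by
    have := hFc.tendsto 0
    rw [hF0] at this
    exact this.eventually hne
  have hφa : AnalyticAt ℂ φ 0 := by
    have e1 : (fun t => wedge U (F (u + t • perp u))) = (C U.1 * q - C U.2 * p).eval := by
      ext t; rw [hpq]; simp [wedge]
    have e2 : (fun t => herm (F (u + t • perp u)) U) =
        (p * C (star U.1) + q * C (star U.2)).eval := by
      ext t; rw [hpq]; simp [herm]
    have := hne'.self_of_nhds
    refine AnalyticAt.fun_div ?_ ?_ this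
    · rw [e1]; exact (Polynomial.differentiable _).analyticAt 0
    · rw [e2]; exact (Polynomial.differentiable _).analyticAt 0
  -- `φ` is `f` in affine charts at `u` and `F u`. If it were locally constant, a polynomial
  -- identity would make `f` constant on the whole chart, so `f` would take at most two values,
  -- against surjectivity.
  have hopen : 𝓝 (0 : ℂ) ≤ map φ (𝓝 0) := by
    rcases hφa.eventually_constant_or_nhds_le_map_nhds with h | h
    · exfalso
      have hzero : C U.1 * q - C U.2 * p = 0 := by
        apply Polynomial.eq_zero_of_infinite_isRoot
        refine Set.Infinite.mono ?_ (infinite_of_mem_nhds 0 (h.and hne'))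
        rintro t ⟨h1, h2⟩
        rw [hφ0] at h1
        have h3 : wedge U (F (u + t • perp u)) = 0 := (div_eq_zero_iff.1 h1).resolve_right h2
        rw [hpq] at h3
        simpa [wedge] using h3
      have hconst (t : ℂ) : f (line t) = toSphere U := by
        have hv := add_smul_perp_ne_zero hu t
        rw [hF.apply_toSphere hv, eq_comm, ← wedge_eq_zero_iff hU (hF.map_ne_zero hv), hpq]
        simpa [wedge] using congrArg (Polynomial.eval t) hzero
      have hrange : Set.range f ⊆ {toSphere U, f (toSphere (perp u))} := by
        rintro _ ⟨y, rfl⟩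
        obtain ⟨v, hv, rfl⟩ := exists_toSphere_eq y
        by_cases hvu : herm v u = 0
        · right
          have h1 := herm_self_smul u v
          rw [hvu, zero_smul, zero_add] at h1
          have h2 : wedge u v ≠ 0 := fun h2 => by
            rw [h2, zero_smul] at h1
            exact smul_ne_zero (herm_self_ne_zero hu) hv h1
          rw [← toSphere_smul (herm_self_ne_zero hu) v, h1, toSphere_smul h2]
          rfl
        · left
          rw [toSphere_eq_add_smul_perp hu hvu]
          exact hconst _
      rw [(hF.surjective hd).range_eq] at hrange
      exact Set.infinite_univ ((Set.toFinite _).subset hrange)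
    · rwa [hφ0] at h
  calc 𝓝 (f (toSphere u)) = 𝓝 (toSphere U) := by rw [hF.apply_toSphere hu]
    _ ≤ map target (map φ (𝓝 0)) := htarget.trans (map_mono hopen)
    _ = map f (map line (𝓝 0)) := by
      rw [map_map, map_map]
      apply Filter.map_congr
      filter_upwards [hne'] with t ht
      simp only [Function.comp_apply, line, target, hφ, hslope]
      rw [hF.apply_toSphere (add_smul_perp_ne_zero hu t), toSphere_eq_add_smul_perp hU ht]
    _ ≤ map f (𝓝 (toSphere u)) := map_mono hline

theorem exists_pos_le_euclNorm (hF : IsHomogeneousLift F d f) :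
    ∃ m > 0, ∀ v ≠ 0, m * euclNorm v ^ d ≤ euclNorm (F v) := by
  have hcpt : IsCompact {v | euclNorm v = 1} := by
    apply Metric.isCompact_of_isClosed_isBounded (isClosed_eq continuous_euclNorm continuous_const)
    rw [Metric.isBounded_iff_subset_closedBall 0]
    refine ⟨1, fun v hv => ?_⟩
    have hv : euclNorm v = 1 := hv
    rw [mem_closedBall_zero_iff, Prod.norm_def, max_le_iff, ← hv]
    exact ⟨Real.le_sqrt_of_sq_le (by nlinarith [sq_nonneg ‖v.2‖]),
      Real.le_sqrt_of_sq_le (by nlinarith [sq_nonneg ‖v.1‖])⟩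
  have hc := hF.continuous
  obtain ⟨v₀, hv₀, hmin⟩ := hcpt.exists_isMinOn ⟨(1, 0), by simp [euclNorm]⟩
    (f := fun v => euclNorm (F v)) (by fun_prop)
  have hv₀' : v₀ ≠ 0 := by
    rintro rfl
    simp [euclNorm] at hv₀
  refine ⟨euclNorm (F v₀), euclNorm_pos (hF.map_ne_zero hv₀'), fun v hv => ?_⟩
  have hv' := euclNorm_pos hv
  have h1 : euclNorm (((euclNorm v)⁻¹ : ℂ) • v) = 1 := by
    rw [euclNorm_smul, norm_inv, Complex.norm_real, Real.norm_of_nonneg hv'.le,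
      inv_mul_cancel₀ hv'.ne']
  have h2 := hmin h1
  simp only [Set.mem_ofPred_eq, hF.map_smul, euclNorm_smul, norm_pow, norm_inv, Complex.norm_real,
    Real.norm_of_nonneg hv'.le, inv_pow] at h2
  rwa [inv_mul_eq_div, le_div_iff₀ (by positivity)] at h2

end IsHomogeneousLift

end Lift

/-! ### Infinitude and minimality of the Julia set -/

section Julia

open Filter Topology

attribute [local instance] sphereMetricSpace

theorem herm_smul_smul (s t : ℂ) (u v : ℂ × ℂ) : herm (s • u) (t • v) = s * star t * herm u v := by
  simp [herm]; ring

theorem exists_continuous_exp_eq {g : ℂ → ℂ} (hg : Continuous g) (h0 : ∀ z, g z ≠ 0) :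
    ∃ L : ℂ → ℂ, Continuous L ∧ ∀ z, Complex.exp (L z) = g z := by
  have : ContractibleSpace (Set.univ : Set ℂ) :=
    (convex_univ (𝕜 := ℝ)).contractibleSpace Set.univ_nonempty
  obtain ⟨L, hL, h⟩ := Complex.exists_continuousOn_eqOn_exp_comp (U := Set.univ)
    (inferInstanceAs (SimplyConnectedSpace (Set.univ : Set ℂ))) isOpen_univ hg.continuousOn
    (by rintro ⟨z, -, hz⟩; exact h0 z hz)
  exact ⟨L, continuousOn_univ.1 hL, fun z => h (Set.mem_univ z)⟩

/-- Both charts are simply connected, so the pairing has continuous logarithms `L₁`, `L₂` there. On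
the unit circle `(z, 1) = z • (1, z̄)` makes the two pairings differ by `z ^ a * z̄ ^ b = z ^ (a -
b)`. Thus `D` takes values in the discrete fibre `exp⁻¹ 1` and is constant; comparing `θ = 0` with
`θ = 2π` gives `a = b`. -/
theorem IsHomogeneousLift.degree_eq_of_herm_ne_zero {F G : ℂ × ℂ → ℂ × ℂ} {a b : ℕ}
    {f g : OnePoint ℂ → OnePoint ℂ} (hF : IsHomogeneousLift F a f) (hG : IsHomogeneousLift G b g)
    (h : ∀ v ≠ 0, herm (F v) (G v) ≠ 0) : a = b := by
  have hFc := hF.continuous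
  have hGc := hG.continuous
  have hc : Continuous fun v => herm (F v) (G v) := by unfold herm; fun_prop
  obtain ⟨L₁, hL₁, h₁⟩ := exists_continuous_exp_eq (g := fun z => herm (F (z, 1)) (G (z, 1)))
    (hc.comp (by fun_prop)) (fun z => h _ (by simp))
  obtain ⟨L₂, hL₂, h₂⟩ := exists_continuous_exp_eq (g := fun z => herm (F (1, z)) (G (1, z)))
    (hc.comp (by fun_prop)) (fun z => h _ (by simp))
  set D : ℝ → ℂ := fun θ => L₁ (Complex.exp (θ * Complex.I)) - L₂ (Complex.exp (-(θ * Complex.I)))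
    - θ * Complex.I * (a - b) with hD
  have hDc : Continuous D := by fun_prop
  have hexp (θ : ℝ) : Complex.exp (D θ) = 1 := by
    set z := Complex.exp (θ * Complex.I) with hz
    have hstar : star z = Complex.exp (-(θ * Complex.I)) := by
      rw [hz, Complex.star_def, ← Complex.exp_conj]; simp
    have hv : (z, (1 : ℂ)) = z • ((1 : ℂ), Complex.exp (-(θ * Complex.I))) := by
      ext
      · simp
      · simp [hz, ← Complex.exp_add]
    have e : Complex.exp (L₁ z) = z ^ a * star z ^ b *
        Complex.exp (L₂ (Complex.exp (-(θ * Complex.I)))) := by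
      rw [h₁, h₂, hv, hF.map_smul, hG.map_smul, herm_smul_smul, star_pow]
    rw [hD]
    simp only
    rw [Complex.exp_sub, Complex.exp_sub, e, hstar, hz, ← Complex.exp_nat_mul,
      ← Complex.exp_nat_mul, mul_div_assoc, div_self (Complex.exp_ne_zero _), mul_one,
      ← Complex.exp_add, ← Complex.exp_sub]
    convert Complex.exp_zero using 2
    ring
  have hconst : D = fun _ => D 0 := by
    refine Complex.isCoveringMap_exp.eq_of_comp_eq hDc continuous_const ?_ 0 rfl
    ext θ
    simp [hexp]
  have h2π := congrFun hconst (2 * Real.pi)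
  simp only [hD, Complex.ofReal_mul, Complex.ofReal_ofNat, Complex.ofReal_zero, zero_mul,
    Complex.exp_neg, Complex.exp_two_pi_mul_I, Complex.exp_zero, inv_one, sub_zero] at h2π
  have h3 : (2 * Real.pi * Complex.I) * ((a : ℂ) - b) = 0 := by linear_combination -h2π
  rcases mul_eq_zero.1 h3 with h4 | h4
  · exact absurd h4 Complex.two_pi_I_ne_zero
  · exact_mod_cast sub_eq_zero.1 h4

theorem dist_toSphere_eq_two {u v : ℂ × ℂ} (hu : u ≠ 0) (hv : v ≠ 0) (h : herm u v = 0) :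
    dist (toSphere u) (toSphere v) = 2 := by
  have hu' := euclNorm_pos hu
  have hv' := euclNorm_pos hv
  have hh := norm_wedge_sq_add_norm_herm_sq u v
  rw [h, norm_zero, zero_pow two_ne_zero, add_zero, ← mul_pow] at hh
  rw [dist_toSphere hu hv, (pow_left_inj₀ (norm_nonneg _) (by positivity) two_ne_zero).1 hh,
    mul_div_assoc, div_self (by positivity), mul_one]

theorem IsHomogeneousLift.juliaSet_nonempty {F : ℂ × ℂ → ℂ × ℂ} {d : ℕ}
    {f : OnePoint ℂ → OnePoint ℂ} (hF : IsHomogeneousLift F d f) (hd : 2 ≤ d) :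
    (juliaSet f).Nonempty := by
  by_contra hcon
  have huniv : fatouSet f = Set.univ :=
    Set.compl_empty_iff.1 (Set.not_nonempty_iff_eq_empty.1 hcon)
  have heq (x : OnePoint ℂ) : EquicontinuousAt (fun n : ℕ => f^[n]) x :=
    ((mem_fatouSet_iff hF.continuous_map).1 (huniv ▸ Set.mem_univ x)).self_of_nhds
  obtain ⟨k, hk, g, hg⟩ := isNormalFamilyOn_of_equicontinuousAt (U := Set.univ)
    (fun x _ => heq x) id
  obtain ⟨N, hN⟩ := hg Set.univ subset_rfl isCompact_univ 1 one_pos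
  have hne : k N ≠ k (N + 1) := (hk (Nat.lt_succ_self N)).ne
  apply hne
  apply Nat.pow_right_injective hd
  refine (hF.iterate (k N)).degree_eq_of_herm_ne_zero (hF.iterate (k (N + 1))) fun v hv h0 => ?_
  have h1 := dist_toSphere_eq_two ((hF.iterate (k N)).map_ne_zero hv)
    ((hF.iterate (k (N + 1))).map_ne_zero hv) h0
  rw [← (hF.iterate _).apply_toSphere hv, ← (hF.iterate _).apply_toSphere hv] at h1
  have h2 := hN N le_rfl (toSphere v) trivial
  have h3 := hN (N + 1) (Nat.le_succ N) (toSphere v) trivial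
  rw [← sphere_dist_eq] at h2 h3
  have h4 := dist_triangle_right (f^[k N] (toSphere v)) (f^[k (N + 1)] (toSphere v)) (g (toSphere v))
  simp only [id] at h2 h3
  linarith

/-- Total ramification at `x`: `F u ∧ F v` is a constant times `(u ∧ v) ^ d`, and `|F v|` is at
least a multiple of `|v| ^ d`. -/
theorem IsHomogeneousLift.exists_dist_le_mul_pow {F : ℂ × ℂ → ℂ × ℂ} {d : ℕ}
    {f : OnePoint ℂ → OnePoint ℂ} (hF : IsHomogeneousLift F d f) {x : OnePoint ℂ}
    (hx : ∀ y, f y = f x → y = x) : ∃ C, ∀ y, dist (f y) (f x) ≤ C * dist y x ^ d := by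
  obtain ⟨u, hu, rfl⟩ := exists_toSphere_eq x
  have hFu := hF.map_ne_zero hu
  obtain ⟨c, hc⟩ := hF.wedge_apply_eq (Y := F u) (u := u) (w := perp u) (fun s h0 => by
    have hv := smul_add_perp_ne_zero hu s
    rw [wedge_eq_zero_iff hFu (hF.map_ne_zero hv), ← hF.apply_toSphere hv,
      ← hF.apply_toSphere hu] at h0
    have h1 := (wedge_eq_zero_iff hu hv).2 (hx _ h0.symm).symm
    have h2 := wedge_smul_add_perp u s 1
    rw [one_smul, h1, one_mul] at h2
    exact herm_self_ne_zero hu h2.symm)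
  obtain ⟨m, hm, hmF⟩ := hF.exists_pos_le_euclNorm
  have hNu := euclNorm_pos hu
  have hNFu := euclNorm_pos hFu
  refine ⟨2 * ‖c‖ / (‖herm u u‖ ^ d * m * euclNorm (F u)) * (euclNorm u / 2) ^ d, fun y => ?_⟩
  obtain ⟨v, hv, rfl⟩ := exists_toSphere_eq y
  have hNv := euclNorm_pos hv
  have hNFv := euclNorm_pos (hF.map_ne_zero hv)
  have hh : 0 < ‖herm u u‖ := norm_pos_iff.2 (herm_self_ne_zero hu)
  obtain ⟨a, ha⟩ := exists_eq_smul_add_smul_perp hu v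
  have hw : wedge (F u) (F v) = c * (wedge u v / herm u u) ^ d := by
    rw [← hc a, ← ha]
  rw [hF.apply_toSphere hv, hF.apply_toSphere hu, dist_comm (toSphere (F v)),
    dist_comm (toSphere v), dist_toSphere hFu (hF.map_ne_zero hv), dist_toSphere hu hv, hw,
    norm_mul, norm_pow, norm_div]
  have e : 2 * ‖c‖ / (‖herm u u‖ ^ d * m * euclNorm (F u)) * (euclNorm u / 2) ^ d *
      (2 * ‖wedge u v‖ / (euclNorm u * euclNorm v)) ^ d =
      2 * (‖c‖ * (‖wedge u v‖ / ‖herm u u‖) ^ d) / (euclNorm (F u) * (m * euclNorm v ^ d)) := by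
    simp only [div_pow, mul_pow]
    field_simp
  rw [e]
  gcongr
  exact hmF v hv

/-- The tail of the sequence is squeezed towards `c n`; the finitely many remaining maps are
continuous. -/
theorem equicontinuousAt_of_eventually_dist_le {F : ℕ → OnePoint ℂ → OnePoint ℂ}
    (hF : ∀ n, Continuous (F n)) {c : ℕ → OnePoint ℂ} {b : ℕ → ℝ} (hb : Tendsto b atTop (𝓝 0))
    {y : OnePoint ℂ} (h : ∀ᶠ z in 𝓝 y, ∀ n, dist (F n z) (c n) ≤ b n) : EquicontinuousAt F y := by
  rw [Metric.equicontinuousAt_iff_right]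
  intro ε hε
  obtain ⟨N, hN⟩ := eventually_atTop.1 (hb.eventually (gt_mem_nhds (half_pos hε)))
  have hfin : ∀ᶠ z in 𝓝 y, ∀ n ∈ Finset.range N, dist (F n y) (F n z) < ε := by
    rw [Filter.eventually_all_finset]
    intro n _
    have := Metric.tendsto_nhds.1 ((hF n).tendsto y) ε hε
    filter_upwards [this] with z hz
    rwa [dist_comm]
  filter_upwards [hfin, h] with z hz hz' n
  rcases lt_or_ge n N with hn | hn
  · exact hz n (Finset.mem_range.2 hn)
  · have h1 := hz' n
    have h2 := h.self_of_nhds n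
    have h3 := hN n hn
    have := dist_triangle_right (F n y) (F n z) (c n)
    linarith

theorem IsHomogeneousLift.juliaSet_infinite {F : ℂ × ℂ → ℂ × ℂ} {d : ℕ}
    {f : OnePoint ℂ → OnePoint ℂ} (hF : IsHomogeneousLift F d f) (hd : 2 ≤ d) :
    (juliaSet f).Infinite := by
  intro hfin
  have hf := hF.continuous_map
  have hd0 : d ≠ 0 := by omega
  obtain ⟨himg, hpre⟩ := isCompletelyInvariant_juliaSet hf (hF.isOpenMap hd0) (hF.surjective hd0)
  have hmem (y : OnePoint ℂ) : f y ∈ juliaSet f ↔ y ∈ juliaSet f := by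
    rw [← Set.mem_preimage, hpre]
  -- A surjection of a finite set to itself is injective. As preimages of Julia points are Julia
  -- points, each such point is the only preimage of its image.
  have hinj : Set.InjOn f (juliaSet f) := by
    rw [← Set.ncard_image_iff hfin, himg]
  have hC : ∀ x ∈ juliaSet f, ∃ C, ∀ y, dist (f y) (f x) ≤ C * dist y x ^ d := fun x hx =>
    hF.exists_dist_le_mul_pow fun y hy => hinj ((hmem y).1 (by rw [hy]; exact (hmem x).2 hx)) hx hy
  choose! C hC using hC
  obtain ⟨B, hB⟩ := (hfin.image C).bddAbove
  set M := max B 1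
  have hM (x : OnePoint ℂ) (hx : x ∈ juliaSet f) (y : OnePoint ℂ) :
      dist (f y) (f x) ≤ M * dist y x ^ d :=
    (hC x hx y).trans (by
      gcongr
      exact (hB ⟨x, hx, rfl⟩).trans (le_max_left _ _))
  have hM1 : 1 ≤ M := le_max_right _ _
  -- Chosen so that `M * r = 1/2`: as `d ≥ 2`, `f` halves distances to Julia points within radius `r
  -- ≤ 1`.
  set r := 1 / (2 * M) with hr
  have hr0 : 0 < r := by positivity
  have hr1 : r ≤ 1 := by
    rw [hr, div_le_one (by positivity)]; linarith
  have hcontr (x : OnePoint ℂ) (hx : x ∈ juliaSet f) (y : OnePoint ℂ) (hy : dist y x ≤ r) :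
      dist (f y) (f x) ≤ dist y x / 2 := by
    refine (hM x hx y).trans ?_
    have h1 : dist y x ^ d ≤ dist y x ^ 2 := pow_le_pow_of_le_one dist_nonneg (hy.trans hr1) hd
    calc M * dist y x ^ d ≤ M * (dist y x * r) := by
          gcongr
          rw [sq] at h1
          exact h1.trans (by gcongr)
      _ = dist y x / 2 := by rw [hr]; field_simp
  obtain ⟨x, hx⟩ := hF.juliaSet_nonempty hd
  have hit (n : ℕ) : f^[n] x ∈ juliaSet f := by
    induction n with
    | zero => exact hx
    | succ n ih => rw [Function.iterate_succ_apply']; exact (hmem _).2 ih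
  have hdist (y : OnePoint ℂ) (hy : dist y x ≤ r) (n : ℕ) :
      dist (f^[n] y) (f^[n] x) ≤ r * (1 / 2) ^ n := by
    induction n with
    | zero => simpa using hy
    | succ n ih =>
      rw [Function.iterate_succ_apply', Function.iterate_succ_apply']
      have h1 : r * (1 / 2) ^ n ≤ r :=
        mul_le_of_le_one_right hr0.le (pow_le_one₀ (by norm_num) (by norm_num))
      refine (hcontr _ (hit n) _ (ih.trans h1)).trans ?_
      rw [pow_succ]
      linarith
  refine hx ((mem_fatouSet_iff hf).2 ?_)
  filter_upwards [Metric.isOpen_ball.mem_nhds (Metric.mem_ball_self (x := x) hr0)] with y hy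
  refine equicontinuousAt_of_eventually_dist_le (fun n => hf.iterate n) (c := fun n => f^[n] x)
    (b := fun n => r * (1 / 2) ^ n) ?_ ?_
  · simpa using (tendsto_pow_atTop_nhds_zero_of_lt_one (by norm_num : (0 : ℝ) ≤ 1 / 2)
      (by norm_num)).const_mul r
  · filter_upwards [Metric.isOpen_ball.mem_nhds hy] with z hz n using hdist z (le_of_lt hz) n

/-- The cross ratio of `v` with `a`, `b`, `c`: it takes the values `0`, `∞`, `1` there. -/
noncomputable def crossRatio (a b c v : ℂ × ℂ) : ℂ :=
  (wedge a v * wedge b c) / (wedge b v * wedge a c)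

theorem norm_wedge_le (u v : ℂ × ℂ) : ‖wedge u v‖ ≤ euclNorm u * euclNorm v := by
  apply le_of_sq_le_sq _ (mul_nonneg (euclNorm_nonneg u) (euclNorm_nonneg v))
  rw [mul_pow, ← norm_wedge_sq_add_norm_herm_sq]
  nlinarith [sq_nonneg ‖herm u v‖]

/-- By the Plücker relation, numerator minus denominator is `-(a ∧ b)(c ∧ v)`. -/
theorem crossRatio_ne_one {a b c v : ℂ × ℂ} (hab : wedge a b ≠ 0) (hac : wedge a c ≠ 0)
    (hbv : wedge b v ≠ 0) (hcv : wedge c v ≠ 0) : crossRatio a b c v ≠ 1 := by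
  intro h
  rw [crossRatio, div_eq_one_iff_eq (mul_ne_zero hbv hac)] at h
  apply mul_ne_zero hab hcv
  simp only [wedge] at h ⊢
  linear_combination -h

/-- The cross ratio is induced by a linear map `L` that multiplies `v ∧ v'` by its determinant and
lengths by at most `k`; so its inverse is chordally Lipschitz with constant `k² / |det L|`. -/
theorem exists_dist_le_mul_sphericalDist_crossRatio {a b c : ℂ × ℂ} (hab : wedge a b ≠ 0)
    (hac : wedge a c ≠ 0) (hbc : wedge b c ≠ 0) : ∃ K > 0, ∀ v v' : ℂ × ℂ, wedge b v ≠ 0 →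
      wedge b v' ≠ 0 → dist (toSphere v) (toSphere v') ≤
        K * sphericalDist (crossRatio a b c v) (crossRatio a b c v') := by
  set L : ℂ × ℂ → ℂ × ℂ := fun v => (wedge a v * wedge b c, wedge b v * wedge a c) with hL
  set k := euclNorm a * ‖wedge b c‖ + euclNorm b * ‖wedge a c‖ with hk
  have hLk (v : ℂ × ℂ) : euclNorm (L v) ≤ k * euclNorm v := by
    have h1 : ‖wedge a v * wedge b c‖ ≤ euclNorm a * euclNorm v * ‖wedge b c‖ := by
      rw [norm_mul]; gcongr; exact norm_wedge_le a v
    have h2 : ‖wedge b v * wedge a c‖ ≤ euclNorm b * euclNorm v * ‖wedge a c‖ := by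
      rw [norm_mul]; gcongr; exact norm_wedge_le b v
    have h3 : euclNorm (L v) ≤ ‖wedge a v * wedge b c‖ + ‖wedge b v * wedge a c‖ := by
      apply Real.sqrt_le_iff.2
      constructor
      · positivity
      · simp only [hL]
        nlinarith [norm_nonneg (wedge a v * wedge b c), norm_nonneg (wedge b v * wedge a c)]
    rw [hk]; linarith
  have hLw (v v' : ℂ × ℂ) :
      wedge (L v) (L v') = wedge a b * wedge a c * wedge b c * wedge v v' := by
    simp only [hL, wedge]; ring
  set δ := ‖wedge a b * wedge a c * wedge b c‖ with hδ
  have hδ0 : 0 < δ := norm_pos_iff.2 (mul_ne_zero (mul_ne_zero hab hac) hbc)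
  have ha : a ≠ 0 := by rintro rfl; simp [wedge] at hab
  have hk0 : 0 < k := by
    have := euclNorm_pos ha
    have := norm_pos_iff.2 hbc
    have := euclNorm_nonneg b
    positivity
  refine ⟨k ^ 2 / δ, by positivity, fun v v' hv hv' => ?_⟩
  have hv0 : v ≠ 0 := by rintro rfl; simp [wedge] at hv
  have hv0' : v' ≠ 0 := by rintro rfl; simp [wedge] at hv'
  have hLv (v : ℂ × ℂ) (hv : wedge b v ≠ 0) :
      L v ≠ 0 ∧ (crossRatio a b c v : OnePoint ℂ) = toSphere (L v) := by
    have h1 : (L v).2 ≠ 0 := mul_ne_zero hv hac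
    exact ⟨fun h => h1 (congrArg Prod.snd h), by simp only [toSphere, if_neg h1]; rfl⟩
  rw [(hLv v hv).2, (hLv v' hv').2, sphericalDist_toSphere (hLv v hv).1 (hLv v' hv').1,
    dist_toSphere hv0 hv0', hLw, norm_mul, ← hδ]
  have p1 := euclNorm_pos hv0
  have p2 := euclNorm_pos hv0'
  have p3 := euclNorm_pos (hLv v hv).1
  have p4 := euclNorm_pos (hLv v' hv').1
  calc 2 * ‖wedge v v'‖ / (euclNorm v * euclNorm v')
      = k ^ 2 / δ * (2 * (δ * ‖wedge v v'‖) / ((k * euclNorm v) * (k * euclNorm v'))) := by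
        field_simp
    _ ≤ _ := by
        gcongr
        · exact hLk v
        · exact hLk v'

theorem IsHomogeneousLift.compl_subset_fatouSet {F : ℂ × ℂ → ℂ × ℂ} {d : ℕ}
    {f : OnePoint ℂ → OnePoint ℂ} (hF : IsHomogeneousLift F d f) {E : Set (OnePoint ℂ)}
    (hE : IsClosed E) (hinv : f ⁻¹' E = E) (hcard : 3 ≤ E.encard) : Eᶜ ⊆ fatouSet f := by
  have hf := hF.continuous_map
  obtain ⟨T, hTE, hT⟩ := Set.exists_subset_encard_eq hcard
  obtain ⟨x, y, z, hxy, hxz, hyz, rfl⟩ := Set.encard_eq_three.1 hT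
  obtain ⟨a, ha, rfl⟩ := exists_toSphere_eq x
  obtain ⟨b, hb, rfl⟩ := exists_toSphere_eq y
  obtain ⟨c, hc, rfl⟩ := exists_toSphere_eq z
  have haE : toSphere a ∈ E := hTE (by simp)
  have hbE : toSphere b ∈ E := hTE (by simp)
  have hcE : toSphere c ∈ E := hTE (by simp)
  rw [Ne, ← wedge_eq_zero_iff ha hb] at hxy
  rw [Ne, ← wedge_eq_zero_iff ha hc] at hxz
  rw [Ne, ← wedge_eq_zero_iff hb hc] at hyz
  obtain ⟨K, hK, hKd⟩ := exists_dist_le_mul_sphericalDist_crossRatio hxy hxz hyz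
  obtain ⟨C, hC, hmontel⟩ := exists_sphericalDist_le_of_omits_zero_one
  have hmem (n : ℕ) (y : OnePoint ℂ) (hy : y ∉ E) : f^[n] y ∉ E := by
    induction n with
    | zero => exact hy
    | succ n ih =>
      rw [Function.iterate_succ_apply']
      exact fun h => ih (hinv.subset h)
  have main (x : OnePoint ℂ) (hx : x ∉ E) : EquicontinuousAt (fun n : ℕ => f^[n]) x := by
    obtain ⟨u, hu, rfl⟩ := exists_toSphere_eq x
    have hne (t : ℂ) := add_smul_perp_ne_zero hu t
    have hnhds : ∀ᶠ t : ℂ in 𝓝 0, toSphere (u + t • perp u) ∉ E := by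
      refine ((hE.isOpen_compl.preimage (continuous_toSphere_add_smul_perp hu)).mem_nhds ?_)
      simpa using hx
    obtain ⟨r, hr, hrE⟩ := Metric.eventually_nhds_iff_ball.1 hnhds
    have hw (n : ℕ) (w : ℂ × ℂ) (hw0 : w ≠ 0) (hwE : toSphere w ∈ E) (t : ℂ)
        (ht : t ∈ Metric.ball 0 r) : wedge w (F^[n] (u + t • perp u)) ≠ 0 := by
      rw [Ne, wedge_eq_zero_iff hw0 ((hF.iterate n).map_ne_zero (hne t)),
        ← (hF.iterate n).apply_toSphere (hne t)]
      intro h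
      exact hmem n _ (hrE t ht) (h ▸ hwE)
    -- Along the chart, the cross ratio of `F^[n]` is a holomorphic function of `t` omitting 0 and
    -- 1, so the Montel estimate gives a Lipschitz constant independent of `n`.
    have hbound (n : ℕ) (t : ℂ) (ht : t ∈ Metric.ball 0 (r / 2)) :
        dist (f^[n] (toSphere u)) (f^[n] (toSphere (u + t • perp u))) ≤ K * (C / r * ‖t‖) := by
      obtain ⟨p, q, hpq⟩ := (hF.iterate n).exists_polynomial_line u (perp u)
      have htr : t ∈ Metric.ball 0 r := Metric.ball_subset_ball (by linarith) ht
      have h0r : (0 : ℂ) ∈ Metric.ball 0 r := Metric.mem_ball_self hr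
      have h1 := hmontel (fun t => crossRatio a b c (F^[n] (u + t • perp u))) 0 r hr
        (by
          intro s hs
          have hden := mul_ne_zero (hw n b hb hbE s hs) hxz
          simp only [hpq] at hden ⊢
          apply DifferentiableAt.differentiableWithinAt
          unfold crossRatio
          refine DifferentiableAt.fun_div ?_ ?_ hden
          · unfold wedge; fun_prop
          · unfold wedge; fun_prop)
        (fun s hs => div_ne_zero (mul_ne_zero (hw n a ha haE s hs) hyz)
          (mul_ne_zero (hw n b hb hbE s hs) hxz))
        (fun s hs => crossRatio_ne_one hxy hxz (hw n b hb hbE s hs) (hw n c hc hcE s hs)) t ht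
      have h2 := hKd _ _ (hw n b hb hbE t htr) (hw n b hb hbE 0 h0r)
      rw [dist_comm, (hF.iterate n).apply_toSphere (hne t), (hF.iterate n).apply_toSphere hu]
      simp only [zero_smul, add_zero, sub_zero] at h1 h2
      exact h2.trans (mul_le_mul_of_nonneg_left h1 hK.le)
    rw [Metric.equicontinuousAt_iff_right]
    intro ε hε
    apply nhds_toSphere_le_map hu
    rw [mem_map]
    have hsmall : ∀ᶠ t : ℂ in 𝓝 0, K * (C / r * ‖t‖) < ε := by
      have : Tendsto (fun t : ℂ => K * (C / r * ‖t‖)) (𝓝 0) (𝓝 (K * (C / r * ‖(0 : ℂ)‖))) :=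
        Continuous.tendsto (by fun_prop) 0
      exact this.eventually (gt_mem_nhds (by simpa using hε))
    filter_upwards [hsmall, Metric.ball_mem_nhds (0 : ℂ) (half_pos hr)] with t ht htr n
    exact (hbound n t htr).trans_lt ht
  intro x hx
  rw [mem_fatouSet_iff hf]
  filter_upwards [hE.isOpen_compl.mem_nhds hx] with y hy using main y hy

end Julia

theorem mainTheorem3 (R : RatFunc ℂ) (hR : 2 ≤ ratDegree R) :
    IsLeast {E : Set (OnePoint ℂ) |
        IsClosed E ∧ IsCompletelyInvariant (ratMap R) E ∧ 3 ≤ E.encard}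
      (juliaSet (ratMap R)) := by
  obtain ⟨F, hF⟩ := exists_isHomogeneousLift_ratMap R
  have hd : ratDegree R ≠ 0 := by omega
  refine ⟨⟨isClosed_juliaSet _, isCompletelyInvariant_juliaSet hF.continuous_map
    (hF.isOpenMap hd) (hF.surjective hd), ?_⟩, ?_⟩
  · rw [(hF.juliaSet_infinite hR).encard_eq]
    exact le_top
  · rintro E ⟨hE, ⟨-, hinv⟩, hcard⟩
    exact Set.compl_subset_comm.1 (hF.compl_subset_fatouSet hE hinv hcard)
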